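/- For $n\ge 0$ let $(q;q)_n=\prod_{j=1}^{n}(1-q^j)$, and let $\left(\frac{5}{n}\right)$ denote the Kronecker symbol (so $\left(\frac{5}{2}\right)=-1$). For every complex number $q$ with $|q|<1$, $$\sum_{n\geq1} \frac{(-1)^{n-1}\, q^{\binom{n+1}{2}}\, (q;q)_n\,(q;q)_{n-1}}{(q;q)_{2n}} \;=\; \sum_{n\geq1} \frac{\left(\frac{5}{n}\right) q^n}{1-q^n},$$ where both series converge absolutely. The same identity holds in the ring $\mathbb{Z}[[q]]$ of formal power series, where both series converge coefficientwise (each power of $q$ occurs with nonzero coefficient in only finitely many terms). -/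

import Mathlib

open scoped PowerSeries.WithPiTopology

/-- The `q`-Pochhammer symbol `(a; q)_n = (1 - a) (1 - a q) ⋯ (1 - a q ^ (n - 1))`. -/
def qPochhammer {R : Type*} [CommRing R] (a q : R) (n : ℕ) : R :=
  ∏ j ∈ Finset.range n, (1 - a * q ^ j)

/-- The Kronecker symbol `(a / n)` for an integer `a` and a natural number `n`.
It is completely multiplicative in `n`, equals the Legendre symbol at odd primes `n`, and
`(a / 2)` is `0`, `1` or `-1` according as `a` is even, `a ≡ ±1 mod 8` or `a ≡ ±3 mod 8`
(these are the values of `ZMod.χ₈`). By convention `(a / 0)` is `1` if `a = ±1`, else `0`.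
(Mathlib's `jacobiSym` agrees with it at odd `n`, but not at even `n`.) -/
def kroneckerSymbol (a : ℤ) (n : ℕ) : ℤ :=
  if n = 0 then (if a.natAbs = 1 then 1 else 0)
  else ZMod.χ₈ (a : ZMod 8) ^ n.factorization 2 * jacobiSym a (n / 2 ^ n.factorization 2)

/-- The constant coefficient of `(X; X)_n` is `1`, so this is an invertible power series and
`PowerSeries.invOfUnit _ 1` is its inverse. -/
theorem constantCoeff_qPochhammer_X (n : ℕ) :
    PowerSeries.constantCoeff (qPochhammer (PowerSeries.X : PowerSeries ℤ) PowerSeries.X n) = 1 := by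
  simp [qPochhammer, map_prod]

/-! Both sides equal `∑_{r ≥ 1} q^(r²) ∑_{0 ≤ b < r} q^(b (r - b))`, the generating function for the
values of the norm form of `ℤ[φ]` at the lattice points of a cone.

Arithmetic side. The coefficient of `q^N`, `N > 0`, in the Lambert series is `∑_{d ∣ N} (5/d)`. It
counts the associate classes of elements of norm `±N` in `ℤ[φ]` (`ncard_classes_eq_sum_divisors`):
the ring is Euclidean, so the splitting of rational primes shows that both counts satisfy `a(pN) +
χ(p) a(N/p) = (1 + χ(p)) a(N)`, where `χ = (5/·)` and `a(N/p)` is read as `0` when `p ∤ N`. Since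
`φ` has norm `-1`, each class contains elements of norm `+N`, and exactly one of its elements is `a
+ b φ²` with `a > 0`, `b ≥ 0` (`exists_associated_cone`, `cone_unique`). With `r = a + b` the norm
`a² + 3ab + b²` becomes `r² + b (r - b)`, where `b < r`.

Series side. The sequence `β_n = (q;q)_n / (q;q)_{2n}` belongs to a Bailey pair relative to `1`
whose `α_r` contains the factor `∑_{b < r} q^(b (r - b))` (`sum_coneSum_invPochhammer`). Inserting
this expansion and summing over `n` by a terminating q-Gauss sum (`sum_pochhammer_kernel`) gives an
identity of finite sums for each `N` (`sum_pochhammer_eq_sum_coneSum`). Its weights, quotients of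
q-Pochhammer symbols, tend to `1` as `N → ∞`. The limit is taken modulo powers of `X` for formal
series and by dominated convergence for complex `q`. -/

/-! ### The Euclidean ring `ℤ[φ]` and its associate classes -/

/-- The ring `ℤ[φ]` of integers of `ℚ(√5)`, where `φ ^ 2 = φ + 1`. -/
abbrev GoldenInt : Type := QuadraticAlgebra ℤ 1 1

namespace GoldenInt

open QuadraticAlgebra

theorem norm_eq (α : GoldenInt) :
    α.norm = α.re * α.re + α.re * α.im - α.im * α.im := by
  simp [norm_def]

theorem eq_zero_of_sq_eq_five_mul_sq {a b : ℤ} (h : a * a = 5 * (b * b)) : b = 0 := by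
  by_contra hb
  have hb' : (b : ℚ) ≠ 0 := by exact_mod_cast hb
  have h5 : ((a : ℚ) / b) * ((a : ℚ) / b) = 5 := by
    field_simp
    have : (a : ℚ) * a = 5 * (b * b) := by exact_mod_cast h
    linarith
  have : IsSquare (5 : ℚ) := ⟨_, h5.symm⟩
  revert this
  norm_num

theorem norm_eq_zero_iff {α : GoldenInt} : α.norm = 0 ↔ α = 0 := by
  refine ⟨fun h => ?_, fun h => by simp [h]⟩
  rw [norm_eq] at h
  -- Completing the square: four times the norm is `(2 re + im)² - 5 im²`.
  have him : α.im = 0 := eq_zero_of_sq_eq_five_mul_sq (a := 2 * α.re + α.im) (by linarith)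
  have hre : α.re = 0 := by simpa [him] using h
  ext <;> simp [him, hre]

instance : IsDomain GoldenInt :=
  have : NoZeroDivisors GoldenInt := ⟨fun {a b} h => by
    have h' : a.norm * b.norm = 0 := by rw [← map_mul, h, QuadraticAlgebra.norm_zero]
    simpa [norm_eq_zero_iff] using h'⟩
  NoZeroDivisors.to_isDomain _

/-- The quotient `α / β = α * star β / norm β` in `ℚ(√5)` is rounded coordinatewise. At an error
with coordinates at most `1/2` in absolute value, the norm form is less than `1` in absolute value.
-/
theorem exists_quotient (α : GoldenInt) {β : GoldenInt} (hβ : β ≠ 0) :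
    ∃ γ : GoldenInt, (α - β * γ).norm.natAbs < β.norm.natAbs := by
  have hn : β.norm ≠ 0 := mt norm_eq_zero_iff.1 hβ
  set c := α * star β with hc
  have hnQ : (β.norm : ℚ) ≠ 0 := by exact_mod_cast hn
  set u : ℚ := c.re / β.norm with hu
  set v : ℚ := c.im / β.norm with hv
  refine ⟨⟨round u, round v⟩, ?_⟩
  set γ : GoldenInt := ⟨round u, round v⟩ with hγ
  have h1 : β.norm * (α - β * γ).norm = (c - algebraMap ℤ _ β.norm * γ).norm := by
    rw [← norm_star β, ← map_mul]
    congr 1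
    rw [algebraMap_norm_eq_mul_star, star_star, hc]
    ring
  have h2 : ((c - algebraMap ℤ _ β.norm * γ).norm : ℚ) =
      β.norm ^ 2 * ((u - round u) ^ 2 + (u - round u) * (v - round v) - (v - round v) ^ 2) := by
    have e1 : (c.re : ℚ) = β.norm * u := by rw [hu]; field_simp
    have e2 : (c.im : ℚ) = β.norm * v := by rw [hv]; field_simp
    rw [norm_eq]
    simp [hγ, e1, e2]
    ring
  have h3 : (β.norm : ℚ) * ((α - β * γ).norm : ℚ) = β.norm ^ 2 *
      ((u - round u) ^ 2 + (u - round u) * (v - round v) - (v - round v) ^ 2) := by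
    rw [← h2, ← h1]; push_cast; ring
  have h4 : ((α - β * γ).norm : ℚ) = β.norm *
      ((u - round u) ^ 2 + (u - round u) * (v - round v) - (v - round v) ^ 2) := by
    apply mul_left_cancel₀ hnQ; rw [h3]; ring
  have hub := abs_sub_round u
  have hvb := abs_sub_round v
  have h5 : |(u - round u) ^ 2 + (u - round u) * (v - round v) - (v - round v) ^ 2| < 1 := by
    generalize u - round u = s at *
    generalize v - round v = t at *
    rw [abs_le] at hub hvb
    rw [abs_lt]
    constructor <;> nlinarith
  have h6 : |((α - β * γ).norm : ℚ)| < |(β.norm : ℚ)| := by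
    rw [h4, abs_mul]
    exact mul_lt_of_lt_one_right (abs_pos.2 hnQ) h5
  zify
  exact_mod_cast h6

open Classical in
noncomputable instance : EuclideanDomain GoldenInt :=
  { (inferInstance : CommRing GoldenInt), (inferInstance : Nontrivial GoldenInt) with
    quotient := fun α β => if h : β ≠ 0 then (exists_quotient α h).choose else 0
    remainder := fun α β => α - β * (if h : β ≠ 0 then (exists_quotient α h).choose else 0)
    quotient_zero := by simp
    quotient_mul_add_remainder_eq := by intros; ring
    r := fun α β => α.norm.natAbs < β.norm.natAbs
    r_wellFounded := (measure fun α : GoldenInt => α.norm.natAbs).wf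
    remainder_lt := fun α β h => by
      simp only [dif_pos h]
      exact (exists_quotient α h).choose_spec
    mul_left_not_lt := fun α β h => by
      rw [map_mul, Int.natAbs_mul, not_lt]
      exact Nat.le_mul_of_pos_right _ (Int.natAbs_pos.2 (mt norm_eq_zero_iff.1 h)) }

theorem isUnit_iff_natAbs_norm {α : GoldenInt} : IsUnit α ↔ α.norm.natAbs = 1 := by
  rw [isUnit_iff_norm_isUnit, Int.isUnit_iff_natAbs_eq]

theorem natAbs_norm_natCast (n : ℕ) : (n : GoldenInt).norm.natAbs = n * n := by
  rw [QuadraticAlgebra.norm_natCast, Int.natAbs_pow, Int.natAbs_natCast, sq]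

theorem natAbs_norm_eq_of_associated {α β : GoldenInt} (h : Associated α β) :
    α.norm.natAbs = β.norm.natAbs := by
  obtain ⟨u, rfl⟩ := h
  rw [map_mul, Int.natAbs_mul, isUnit_iff_natAbs_norm.1 u.isUnit, mul_one]

/-- The associate classes of elements of norm `±N`. -/
def classes (N : ℕ) : Set (Associates GoldenInt) := Associates.mk '' {α | α.norm.natAbs = N}

theorem mk_mem_classes {α : GoldenInt} {N : ℕ} :
    Associates.mk α ∈ classes N ↔ α.norm.natAbs = N := by
  constructor
  · rintro ⟨β, hβ, h⟩
    rw [← natAbs_norm_eq_of_associated (Associates.mk_eq_mk_iff_associated.1 h)]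
    exact hβ
  · exact fun h => ⟨α, h, rfl⟩

/-- Multiplication by `γ` is a bijection from the classes of norm `±N` onto the right-hand classes
divisible by `γ`. The prime recursions all reduce to this count. -/
theorem ncard_classes_dvd {γ : GoldenInt} (hγ : γ ≠ 0) (N : ℕ) :
    {x ∈ classes (γ.norm.natAbs * N) | Associates.mk γ ∣ x}.ncard = (classes N).ncard := by
  symm
  have hγ' : γ.norm.natAbs ≠ 0 := by simpa [norm_eq_zero_iff] using hγ
  refine Set.ncard_congr (fun x _ => Associates.mk γ * x) ?_ ?_ ?_
  · rintro _ ⟨α, hα, rfl⟩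
    refine ⟨?_, Dvd.intro _ rfl⟩
    rw [Associates.mk_mul_mk, mk_mem_classes, map_mul, Int.natAbs_mul, hα]
  · intro a b _ _ h
    exact mul_left_cancel₀ (Associates.mk_ne_zero.2 hγ) h
  · rintro x ⟨hx, y, rfl⟩
    obtain ⟨β, rfl⟩ := Associates.mk_surjective y
    rw [Associates.mk_mul_mk, mk_mem_classes, map_mul, Int.natAbs_mul] at hx
    exact ⟨_, mk_mem_classes.2 (Nat.eq_of_mul_eq_mul_left (Nat.pos_of_ne_zero hγ') hx), rfl⟩

theorem natAbs_norm_dvd {α β : GoldenInt} (h : α ∣ β) : α.norm.natAbs ∣ β.norm.natAbs := by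
  obtain ⟨γ, rfl⟩ := h
  rw [map_mul, Int.natAbs_mul]
  exact Dvd.intro _ rfl

theorem natCast_dvd {n : ℕ} {α : GoldenInt} (h1 : (n : ℤ) ∣ α.re) (h2 : (n : ℤ) ∣ α.im) :
    (n : GoldenInt) ∣ α := by
  obtain ⟨a, ha⟩ := h1
  obtain ⟨b, hb⟩ := h2
  exact ⟨⟨a, b⟩, by ext <;> simp [ha, hb]⟩

theorem prime_of_natAbs_norm {p : ℕ} (hp : p.Prime) {π : GoldenInt} (hπ : π.norm.natAbs = p) :
    Prime π := by
  refine Irreducible.prime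
    ⟨fun hu => hp.one_lt.ne' (hπ ▸ isUnit_iff_natAbs_norm.1 hu), fun a b hab => ?_⟩
  rw [isUnit_iff_natAbs_norm, isUnit_iff_natAbs_norm]
  rw [hab, map_mul, Int.natAbs_mul] at hπ
  rcases Nat.prime_mul_iff.1 (hπ ▸ hp) with h | h
  · exact Or.inr h.2
  · exact Or.inl h.2

/-- An element whose norm is a prime up to sign divides `α` or its conjugate as soon as the
prime divides the norm of `α`. -/
theorem dvd_or_star_dvd {p : ℕ} (hp : p.Prime) {π : GoldenInt} (hπ : π.norm.natAbs = p)
    {α : GoldenInt} (h : p ∣ α.norm.natAbs) : π ∣ α ∨ star π ∣ α := by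
  have hπp : π ∣ algebraMap ℤ _ α.norm := by
    have h1 : π ∣ algebraMap ℤ _ π.norm := ⟨star π, algebraMap_norm_eq_mul_star π⟩
    refine h1.trans ((map_dvd (algebraMap ℤ GoldenInt)) ?_)
    rw [← Int.natAbs_dvd_natAbs, hπ]
    exact h
  rw [algebraMap_norm_eq_mul_star] at hπp
  rcases (prime_of_natAbs_norm hp hπ).dvd_or_dvd hπp with h | ⟨γ, hγ⟩
  · exact Or.inl h
  · exact Or.inr ⟨star γ, by rw [← star_star α, hγ, star_mul']⟩

theorem prime_dvd_re_of_dvd_im {p : ℕ} (hp : p.Prime) {α : GoldenInt} (h : p ∣ α.norm.natAbs)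
    (him : (p : ℤ) ∣ α.im) : (p : ℤ) ∣ α.re := by
  have hp' : Prime (p : ℤ) := Nat.prime_iff_prime_int.1 hp
  have h' : (p : ℤ) ∣ α.norm := Int.natCast_dvd.2 h
  rw [norm_eq] at h'
  have : (p : ℤ) ∣ α.re * α.re := by
    have h2 : α.re * α.re = α.re * α.re + α.re * α.im - α.im * α.im
      - α.im * (α.re - α.im) := by ring
    rw [h2]
    exact dvd_sub h' (him.mul_right _)
  exact (hp'.dvd_or_dvd this).elim id id

end GoldenInt

/-! ### Counting classes at inert, ramified and split primes -/

namespace GoldenInt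

open QuadraticAlgebra

/-- A prime whose norm form has no nontrivial zero modulo `p` stays prime in `ℤ[φ]`. -/
theorem ncard_classes_of_inert {p : ℕ} (hp : p.Prime)
    (h : ∀ α : GoldenInt, p ∣ α.norm.natAbs → (p : ℤ) ∣ α.im) (N : ℕ) :
    (classes (p * N)).ncard = if p ∣ N then (classes (N / p)).ncard else 0 := by
  have hdvd : ∀ α : GoldenInt, α.norm.natAbs = p * N → (p : GoldenInt) ∣ α := fun α hα => by
    have hα' : p ∣ α.norm.natAbs := hα ▸ Dvd.intro _ rfl
    exact natCast_dvd (prime_dvd_re_of_dvd_im hp hα' (h α hα')) (h α hα')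
  have hp0 : (p : GoldenInt) ≠ 0 := Nat.cast_ne_zero.2 hp.ne_zero
  split_ifs with hN
  · obtain ⟨M, rfl⟩ := hN
    rw [Nat.mul_div_cancel_left _ hp.pos, ← ncard_classes_dvd hp0 M, natAbs_norm_natCast]
    congr 1
    ext x
    rw [← mul_assoc]
    refine ⟨?_, fun hx => hx.1⟩
    rintro ⟨α, hα, rfl⟩
    exact ⟨mk_mem_classes.2 hα, Associates.mk_le_mk_iff_dvd.2 (hdvd α (hα.trans (mul_assoc _ _ _)))⟩
  · rw [show classes (p * N) = ∅ from ?_, Set.ncard_empty]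
    rw [Set.eq_empty_iff_forall_notMem]
    rintro _ ⟨α, hα, rfl⟩
    have h1 := natAbs_norm_dvd (hdvd α hα)
    rw [natAbs_norm_natCast, hα] at h1
    exact hN (Nat.dvd_of_mul_dvd_mul_left hp.pos h1)

/-- Since `π` divides its conjugate, `dvd_or_star_dvd` makes `π` a divisor of every element of norm
`±pN`, so dividing by `π` loses nothing. -/
theorem ncard_classes_of_ramified {p : ℕ} (hp : p.Prime) {π : GoldenInt}
    (hπ : π.norm.natAbs = p) (hs : π ∣ star π) (N : ℕ) :
    (classes (p * N)).ncard = (classes N).ncard := by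
  have hπ0 : π ≠ 0 := by rintro rfl; simp at hπ; exact hp.ne_zero hπ.symm
  rw [← ncard_classes_dvd hπ0 N, hπ]
  congr 1
  ext x
  refine ⟨?_, fun hx => hx.1⟩
  rintro ⟨α, hα, rfl⟩
  refine ⟨mk_mem_classes.2 hα, Associates.mk_le_mk_iff_dvd.2 ?_⟩
  rcases dvd_or_star_dvd hp hπ (hα ▸ Dvd.intro _ rfl : p ∣ α.norm.natAbs) with h | h
  · exact h
  · exact hs.trans h

/-- Otherwise `π` divides `π - star π`, of norm `-5 im²`, so `p` divides `im`, hence also `re`,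
hence `π` itself. Then `p²` would divide `norm π = ±p`. -/
theorem not_dvd_star {p : ℕ} (hp : p.Prime) (hp5 : p ≠ 5) {π : GoldenInt}
    (hπ : π.norm.natAbs = p) : ¬ π ∣ star π := by
  intro h
  have hp' : Prime (p : ℤ) := Nat.prime_iff_prime_int.1 hp
  have h1 : π ∣ π - star π := dvd_sub dvd_rfl h
  have h2 := natAbs_norm_dvd h1
  have h3 : (π - star π).norm = -(5 * (π.im * π.im)) := by
    rw [norm_eq]; simp; ring
  rw [hπ, ← Int.natCast_dvd, h3, dvd_neg] at h2
  have him : (p : ℤ) ∣ π.im := by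
    rcases hp'.dvd_or_dvd h2 with h | h
    · have : p ∣ 5 := by exact_mod_cast h
      exact absurd ((Nat.prime_dvd_prime_iff_eq hp (by norm_num)).1 this) hp5
    · exact (hp'.dvd_or_dvd h).elim id id
  have h4 := natAbs_norm_dvd (natCast_dvd
    (prime_dvd_re_of_dvd_im hp (hπ ▸ dvd_rfl : p ∣ π.norm.natAbs) him) him)
  rw [natAbs_norm_natCast, hπ] at h4
  have := Nat.le_of_dvd hp.pos h4
  nlinarith [hp.two_le]

/-- Inclusion-exclusion: every class of norm `±pN` is divisible by `π` or by `star π`, and by both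
exactly when it is divisible by `p`, an associate of `π * star π`. -/
theorem ncard_classes_of_split {p : ℕ} (hp : p.Prime) (hp5 : p ≠ 5) {π : GoldenInt}
    (hπ : π.norm.natAbs = p) (N : ℕ) (hfin : (classes (p * N)).Finite) :
    (classes (p * N)).ncard + (if p ∣ N then (classes (N / p)).ncard else 0) =
      2 * (classes N).ncard := by
  have hπ0 : π ≠ 0 := by rintro rfl; simp at hπ; exact hp.ne_zero hπ.symm
  have hπs : (star π).norm.natAbs = p := by rw [QuadraticAlgebra.norm_star, hπ]
  have hπs0 : star π ≠ 0 := star_ne_zero.2 hπ0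
  have hp0 : (p : GoldenInt) ≠ 0 := Nat.cast_ne_zero.2 hp.ne_zero
  set D : Set (Associates GoldenInt) := {x ∈ classes (p * N) | Associates.mk π ∣ x} with hD
  set E : Set (Associates GoldenInt) := {x ∈ classes (p * N) | Associates.mk (star π) ∣ x} with hE
  have hDc : D.ncard = (classes N).ncard := by rw [← ncard_classes_dvd hπ0, hπ]
  have hEc : E.ncard = (classes N).ncard := by rw [← ncard_classes_dvd hπs0, hπs]
  have hunion : D ∪ E = classes (p * N) := by
    ext x
    refine ⟨fun hx => hx.elim And.left And.left, ?_⟩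
    rintro ⟨α, hα, rfl⟩
    have hα' := mk_mem_classes.2 hα
    rcases dvd_or_star_dvd hp hπ (hα ▸ Dvd.intro _ rfl : p ∣ α.norm.natAbs) with h | h
    · exact Or.inl ⟨hα', Associates.mk_le_mk_iff_dvd.2 h⟩
    · exact Or.inr ⟨hα', Associates.mk_le_mk_iff_dvd.2 h⟩
  have hass : Associated (p : GoldenInt) (π * star π) := by
    rw [← algebraMap_norm_eq_mul_star]
    rcases Int.natAbs_eq_iff.1 hπ with h | h
    · rw [h]; simp
    · rw [h]; simp
  have hinter : D ∩ E = {x ∈ classes (p * N) | Associates.mk (p : GoldenInt) ∣ x} := by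
    ext x
    obtain ⟨α, rfl⟩ := Associates.mk_surjective x
    simp only [hD, hE, Set.mem_inter_iff, Set.mem_ofPred_eq, Associates.mk_dvd_mk]
    rw [hass.dvd_iff_dvd_left]
    refine ⟨fun h => ⟨h.1.1, ?_⟩, fun h => ⟨⟨h.1, (Dvd.intro _ rfl).trans h.2⟩, h.1,
      (Dvd.intro_left _ rfl).trans h.2⟩⟩
    obtain ⟨β, hβ⟩ := h.1.2
    rcases (prime_of_natAbs_norm hp hπs).dvd_or_dvd (hβ ▸ h.2.2) with h' | ⟨γ, rfl⟩
    · exact absurd (by rwa [star_star]) (not_dvd_star hp hp5 hπs)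
    · exact ⟨γ, by rw [hβ, mul_assoc]⟩
  have hic : (D ∩ E).ncard = if p ∣ N then (classes (N / p)).ncard else 0 := by
    rw [hinter]
    split_ifs with hN
    · obtain ⟨M, rfl⟩ := hN
      rw [Nat.mul_div_cancel_left _ hp.pos, ← ncard_classes_dvd hp0 M, natAbs_norm_natCast,
        mul_assoc]
    · rw [show {x ∈ classes (p * N) | Associates.mk (p : GoldenInt) ∣ x} = ∅ from ?_,
        Set.ncard_empty]
      rw [Set.eq_empty_iff_forall_notMem]
      rintro _ ⟨⟨α, hα, rfl⟩, h⟩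
      have h1 := natAbs_norm_dvd (Associates.mk_dvd_mk.1 h)
      rw [natAbs_norm_natCast, hα] at h1
      exact hN (Nat.dvd_of_mul_dvd_mul_left hp.pos h1)
  have hDf : D.Finite := hfin.subset (fun x hx => hx.1)
  have hEf : E.Finite := hfin.subset (fun x hx => hx.1)
  have := Set.ncard_union_add_ncard_inter D E hDf hEf
  rw [hunion, hic, hDc, hEc] at this
  omega

/-- If `t ^ 2 + t - 1` vanishes modulo the prime `p`, then `p` is a norm up to sign. -/
theorem exists_natAbs_norm_eq_prime {p : ℕ} (hp : p.Prime) {t : ℤ}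
    (ht : (p : ℤ) ∣ t * t + t - 1) : ∃ π : GoldenInt, π.norm.natAbs = p := by
  have hnp : ¬ Prime (p : GoldenInt) := by
    intro hprime
    -- Here `(t + φ)(t + 1 - φ) = t² + t - 1`, and neither factor is divisible by `p`, since the
    -- coefficients of `φ` are `±1`. So `p` is not prime, and a proper factor of it has norm `±p`.
    have h1 : (p : GoldenInt) ∣ (⟨t, 1⟩ : GoldenInt) * ⟨t + 1, -1⟩ := by
      refine natCast_dvd ?_ ?_
      · simp; convert ht using 1; ring
      · simp
    have key : ∀ a b : ℤ, (p : GoldenInt) ∣ ⟨a, b⟩ → (p : ℤ) ∣ b := by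
      rintro a b ⟨γ, hγ⟩
      refine ⟨γ.im, ?_⟩
      have := congrArg QuadraticAlgebra.im hγ
      simpa using this
    have hp1 : ¬ (p : ℤ) ∣ 1 := by
      intro h
      have : p ∣ 1 := by exact_mod_cast h
      exact hp.one_lt.ne' (Nat.dvd_one.1 this)
    rcases hprime.dvd_or_dvd h1 with h | h
    · exact hp1 (key _ _ h)
    · exact hp1 (by simpa using key _ _ h)
  have hnirr : ¬ Irreducible (p : GoldenInt) := fun h => hnp h.prime
  have hnu : ¬ IsUnit (p : GoldenInt) := by
    rw [isUnit_iff_natAbs_norm, natAbs_norm_natCast]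
    intro h
    exact hp.one_lt.ne' (Nat.eq_one_of_mul_eq_one_left h)
  obtain ⟨a, b, hab, ha, hb⟩ : ∃ a b, (p : GoldenInt) = a * b ∧ ¬ IsUnit a ∧ ¬ IsUnit b := by
    simpa [irreducible_iff, hnu, not_forall, not_or] using hnirr
  rw [isUnit_iff_natAbs_norm] at ha hb
  refine ⟨a, ((hp.mul_eq_prime_sq_iff ha hb).1 ?_).1⟩
  rw [← Int.natAbs_mul, ← map_mul, ← hab, natAbs_norm_natCast, sq]

end GoldenInt

/-! ### The Kronecker symbol -/

theorem kroneckerSymbol_one (a : ℤ) : kroneckerSymbol a 1 = 1 := by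
  simp [kroneckerSymbol]

theorem kroneckerSymbol_mul (a : ℤ) {m n : ℕ} (hm : m ≠ 0) (hn : n ≠ 0) :
    kroneckerSymbol a (m * n) = kroneckerSymbol a m * kroneckerSymbol a n := by
  have h2 : ordCompl[2] m ≠ 0 := (Nat.ordCompl_pos 2 hm).ne'
  have h2' : ordCompl[2] n ≠ 0 := (Nat.ordCompl_pos 2 hn).ne'
  rw [kroneckerSymbol, kroneckerSymbol, kroneckerSymbol, if_neg hm, if_neg hn,
    if_neg (mul_ne_zero hm hn), Nat.ordCompl_mul, jacobiSym.mul_right' a h2 h2',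
    Nat.factorization_mul hm hn, Finsupp.add_apply, pow_add]
  ring

theorem kroneckerSymbol_five_two : kroneckerSymbol 5 2 = -1 := by
  rw [kroneckerSymbol, if_neg two_ne_zero, Nat.Prime.factorization_self Nat.prime_two]
  simp

theorem kroneckerSymbol_of_odd (a : ℤ) {n : ℕ} (hn : Odd n) : kroneckerSymbol a n = jacobiSym a n := by
  have h : n.factorization 2 = 0 :=
    Nat.factorization_eq_zero_of_not_dvd (by rwa [← even_iff_two_dvd, Nat.not_even_iff_odd])
  rw [kroneckerSymbol, if_neg hn.pos.ne', h]
  simp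

/-! ### The splitting law and the recursion for class counts -/

namespace GoldenInt

open QuadraticAlgebra

theorem prime_dvd_im_of_kroneckerSymbol_eq_neg_one {p : ℕ} (hp : p.Prime)
    (h : kroneckerSymbol 5 p = -1) {α : GoldenInt} (hα : p ∣ α.norm.natAbs) :
    (p : ℤ) ∣ α.im := by
  have hα' : (p : ℤ) ∣ α.norm := Int.natCast_dvd.2 hα
  rw [norm_eq] at hα'
  rcases hp.eq_two_or_odd' with rfl | hodd
  · change (2 : ℤ) ∣ _ at hα'
    change (2 : ℤ) ∣ _
    rw [← even_iff_two_dvd] at hα' ⊢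
    revert hα'
    simp only [Int.even_add, Int.even_sub, Int.even_mul]
    tauto
  · rw [kroneckerSymbol_of_odd 5 hodd] at h
    have := Fact.mk hp
    refine (jacobiSym.prime_dvd_of_eq_neg_one h (x := 2 * α.re + α.im) (y := α.im) ?_).2
    -- Four times the norm is `x² - 5 y²` with `x = 2 re + im`, `y = im`; as `5` is a nonresidue,
    -- `p` divides `x` and `y`.
    exact (hα'.mul_left 4).trans ⟨1, by ring⟩

theorem exists_root_of_kroneckerSymbol_eq_one {p : ℕ} (hp : p.Prime)
    (h : kroneckerSymbol 5 p = 1) : ∃ t : ℤ, (p : ℤ) ∣ t * t + t - 1 := by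
  rcases hp.eq_two_or_odd' with rfl | hodd
  · rw [kroneckerSymbol_five_two] at h
    norm_num at h
  · rw [kroneckerSymbol_of_odd 5 hodd] at h
    have := Fact.mk hp
    obtain ⟨s, hs⟩ := ZMod.isSquare_of_jacobiSym_eq_one h
    obtain ⟨u, rfl⟩ := ZMod.intCast_surjective s
    obtain ⟨k, hk⟩ := hodd
    have h2 : ((2 : ℤ) : ZMod p) * (-k) = 1 := by
      have : ((2 * k + 1 : ℕ) : ZMod p) = 0 := by rw [← hk]; exact ZMod.natCast_self p
      push_cast at this ⊢
      linear_combination -this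
    -- The polynomial `t² + t - 1` has discriminant `5 = u²` modulo `p`, and `-k` is the inverse of
    -- `2` modulo `p = 2k + 1`, so this is the root `(u - 1) / 2`.
    refine ⟨(u - 1) * (-k), ?_⟩
    rw [← ZMod.intCast_zmod_eq_zero_iff_dvd]
    push_cast at h2 hs ⊢
    linear_combination (-(k : ZMod p) * (k : ZMod p)) * hs +
      ((3 - u : ZMod p) * (-k) + 1) * h2

theorem ncard_classes_prime_mul {p : ℕ} (hp : p.Prime) (N : ℕ) (hfin : (classes (p * N)).Finite) :
    ((classes (p * N)).ncard : ℤ) +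
        kroneckerSymbol 5 p * (if p ∣ N then ((classes (N / p)).ncard : ℤ) else 0) =
      (1 + kroneckerSymbol 5 p) * (classes N).ncard := by
  have htri : kroneckerSymbol 5 p = 0 ∨ kroneckerSymbol 5 p = 1 ∨ kroneckerSymbol 5 p = -1 := by
    rcases hp.eq_two_or_odd' with rfl | hodd
    · exact Or.inr (Or.inr kroneckerSymbol_five_two)
    · rw [kroneckerSymbol_of_odd 5 hodd]
      exact jacobiSym.trichotomy 5 p
  by_cases hp5 : p = 5
  · subst hp5
    have h0 : kroneckerSymbol 5 5 = 0 := by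
      rw [kroneckerSymbol_of_odd 5 (by decide)]
      exact jacobiSym.eq_zero_iff.2 ⟨by norm_num, by decide⟩
    -- The element `-1 + 2φ` is `√5`, of norm `-5`, and its conjugate is its negative.
    rw [h0, ncard_classes_of_ramified hp (π := ⟨-1, 2⟩) (by simp [norm_eq])
      ⟨-1, by ext <;> simp⟩]
    simp
  rcases htri with h | h | h
  · exfalso
    rcases hp.eq_two_or_odd' with rfl | hodd
    · rw [kroneckerSymbol_five_two] at h
      norm_num at h
    · rw [kroneckerSymbol_of_odd 5 hodd, jacobiSym.eq_zero_iff] at h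
      refine h.2 ?_
      exact (Nat.coprime_primes (by norm_num) hp).2 (Ne.symm hp5)
  · obtain ⟨t, ht⟩ := exists_root_of_kroneckerSymbol_eq_one hp h
    obtain ⟨π, hπ⟩ := exists_natAbs_norm_eq_prime hp ht
    have := ncard_classes_of_split hp hp5 hπ N hfin
    rw [h]
    split_ifs at this ⊢ <;> omega
  · rw [h, ncard_classes_of_inert hp fun α => prime_dvd_im_of_kroneckerSymbol_eq_neg_one hp h]
    split_ifs <;> simp

end GoldenInt

/-! ### The same recursion for divisor sums -/

/-- Among the divisors of `pM`, the multiples of `p` contribute `f p` times the divisor sum of `M`,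
and the others are the divisors of `M` prime to `p`. If `N = pM`, these others are the same for `N`
and `M` and can be eliminated. -/
theorem sum_divisors_prime_mul {f : ℕ → ℤ}
    (hf : ∀ m n, m ≠ 0 → n ≠ 0 → f (m * n) = f m * f n) {p : ℕ} (hp : p.Prime) {N : ℕ}
    (hN : N ≠ 0) :
    (∑ d ∈ (p * N).divisors, f d) + f p * (if p ∣ N then ∑ d ∈ (N / p).divisors, f d else 0) =
      (1 + f p) * ∑ d ∈ N.divisors, f d := by
  have key : ∀ M, M ≠ 0 → ∑ d ∈ (p * M).divisors, f d =
      f p * ∑ d ∈ M.divisors, f d + ∑ d ∈ M.divisors with ¬ p ∣ d, f d := by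
    intro M hM
    rw [← Finset.sum_filter_add_sum_filter_not (p * M).divisors (p ∣ ·)]
    congr 1
    · rw [Finset.mul_sum]
      symm
      refine Finset.sum_bij (fun d _ => p * d) ?_ ?_ ?_ ?_
      · intro d hd
        rw [Nat.mem_divisors] at hd
        rw [Finset.mem_filter, Nat.mem_divisors]
        exact ⟨⟨Nat.mul_dvd_mul_left p hd.1, mul_ne_zero hp.ne_zero hM⟩, Dvd.intro _ rfl⟩
      · intro a _ b _ h
        exact Nat.eq_of_mul_eq_mul_left hp.pos h
      · intro b hb
        rw [Finset.mem_filter, Nat.mem_divisors] at hb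
        obtain ⟨⟨h1, -⟩, d, rfl⟩ := hb
        exact ⟨d, Nat.mem_divisors.2 ⟨Nat.dvd_of_mul_dvd_mul_left hp.pos h1, hM⟩, rfl⟩
      · intro d hd
        exact (hf p d hp.ne_zero (Nat.pos_of_mem_divisors hd).ne').symm
    · refine Finset.sum_congr ?_ fun _ _ => rfl
      ext d
      simp only [Finset.mem_filter, Nat.mem_divisors, mul_ne_zero_iff]
      refine ⟨fun h => ⟨⟨?_, hM⟩, h.2⟩, fun h => ⟨⟨h.1.1.mul_left p, hp.ne_zero, hM⟩, h.2⟩⟩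
      exact (Nat.Coprime.dvd_mul_left ((hp.coprime_iff_not_dvd.2 h.2).symm)).1 h.1.1
  rw [key N hN]
  split_ifs with h
  · obtain ⟨M, rfl⟩ := h
    have hM : M ≠ 0 := right_ne_zero_of_mul hN
    rw [Nat.mul_div_cancel_left _ hp.pos]
    have h2 : ∑ d ∈ (p * M).divisors with ¬ p ∣ d, f d = ∑ d ∈ M.divisors with ¬ p ∣ d, f d := by
      refine Finset.sum_congr ?_ fun _ _ => rfl
      ext d
      simp only [Finset.mem_filter, Nat.mem_divisors, mul_ne_zero_iff]
      refine ⟨fun h => ⟨⟨?_, hM⟩, h.2⟩, fun h => ⟨⟨h.1.1.mul_left p, hp.ne_zero, hM⟩, h.2⟩⟩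
      exact (Nat.Coprime.dvd_mul_left ((hp.coprime_iff_not_dvd.2 h.2).symm)).1 h.1.1
    rw [h2]
    linear_combination -key M hM
  · have h2 : ∑ d ∈ N.divisors with ¬ p ∣ d, f d = ∑ d ∈ N.divisors, f d := by
      refine Finset.sum_congr (Finset.filter_true_of_mem fun d hd => ?_) fun _ _ => rfl
      exact fun hpd => h (hpd.trans (Nat.dvd_of_mem_divisors hd))
    rw [h2]
    ring

namespace GoldenInt

/-- Both sides are `1` at `N = 1` and obey the same recursion, which determines the value at `N =
pM` from those at `M` and `M / p`. -/
theorem ncard_classes_eq_sum_divisors (hfin : ∀ N, N ≠ 0 → (classes N).Finite) {N : ℕ}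
    (hN : N ≠ 0) : ((classes N).ncard : ℤ) = ∑ d ∈ N.divisors, kroneckerSymbol 5 d := by
  induction N using Nat.strong_induction_on with
  | _ N ih =>
    by_cases h1 : N = 1
    · subst h1
      have : classes 1 = {1} := by
        ext x
        obtain ⟨α, rfl⟩ := Associates.mk_surjective x
        rw [mk_mem_classes, ← isUnit_iff_natAbs_norm, Set.mem_singleton_iff,
          Associates.mk_eq_one]
      simp [this, kroneckerSymbol_one]
    · have hp := Nat.minFac_prime h1
      obtain ⟨M, hM⟩ := N.minFac_dvd
      set p := N.minFac
      have hM0 : M ≠ 0 := by rintro rfl; exact hN (by simpa using hM)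
      have hlt : M < N := by
        rw [hM]
        exact lt_mul_left (Nat.pos_of_ne_zero hM0) hp.one_lt
      have e1 := ncard_classes_prime_mul hp M (hM ▸ hfin N hN)
      have e2 := sum_divisors_prime_mul (fun m n => kroneckerSymbol_mul 5) hp hM0
      rw [← hM] at e1 e2
      rw [ih M hlt hM0] at e1
      split_ifs at e1 e2 with h
      · have hMp : M / p ≠ 0 := (Nat.div_pos (Nat.le_of_dvd (Nat.pos_of_ne_zero hM0) h) hp.pos).ne'
        rw [ih (M / p) ((Nat.div_le_self _ _).trans_lt hlt) hMp] at e1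
        linarith
      · linarith

end GoldenInt

/-! ### A cone as fundamental domain for the units -/

namespace GoldenInt

open QuadraticAlgebra

/-- Multiplication by `φ ^ 2` in the basis `1, φ ^ 2`. -/
theorem associated_rotate (a b : ℤ) :
    Associated (⟨a + b, b⟩ : GoldenInt) ⟨-b + (a + 3 * b), a + 3 * b⟩ := by
  have hu : IsUnit (⟨1, 1⟩ : GoldenInt) := isUnit_iff_natAbs_norm.2 (by simp [norm_eq])
  refine ⟨hu.unit, ?_⟩
  rw [IsUnit.unit_spec]
  ext <;> simp <;> ring

theorem associated_neg_mk (a b : ℤ) :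
    Associated (⟨a + b, b⟩ : GoldenInt) ⟨-a + -b, -b⟩ := by
  refine ⟨-1, ?_⟩
  ext <;> simp <;> ring

/-- Every element of positive norm is associated to some `a + b φ ^ 2` with `a > 0`, `b ≥ 0`. -/
theorem exists_associated_cone (a b : ℤ) (h : 0 < a * a + 3 * (a * b) + b * b) :
    ∃ c d : ℤ, 0 < c ∧ 0 ≤ d ∧ Associated (⟨a + b, b⟩ : GoldenInt) ⟨c + d, d⟩ := by
  induction hk : a.natAbs + b.natAbs using Nat.strong_induction_on generalizing a b with
  | _ k ih =>
    wlog ha : 0 ≤ a generalizing a b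
    · obtain ⟨c, d, hc, hd, hass⟩ := this (-a) (-b) (by linarith) (by simpa using hk) (by omega)
      exact ⟨c, d, hc, hd, (associated_neg_mk a b).trans hass⟩
    rcases le_or_gt 0 b with hb | hb
    · rcases ha.eq_or_lt with rfl | ha
      · have hb' : 0 < b := by
          refine hb.lt_of_ne ?_
          rintro rfl
          simp at h
        refine ⟨b, 0, hb', le_rfl, ?_⟩
        have h1 := associated_rotate b 0
        simp only [mul_zero, add_zero, neg_zero] at h1 ⊢
        exact h1.symm
      · exact ⟨a, b, ha, hb, Associated.refl _⟩
    · obtain ⟨l, rfl⟩ : ∃ l, b = -l := ⟨-b, by ring⟩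
      have hl : 0 < l := by linarith
      have hrot := associated_rotate a (-l)
      have hrot' : Associated (⟨a + -l, -l⟩ : GoldenInt) ⟨(3 * a - l) + -a, -a⟩ := by
        have := associated_rotate (3 * a - l) (-a)
        rw [show (-(-a) + (3 * a - l + 3 * -a) : ℤ) = a + -l by ring,
          show (3 * a - l + 3 * -a : ℤ) = -l by ring] at this
        exact this.symm
      rcases le_or_gt (3 * l) a with h3 | h3
      · exact ⟨l, a - 3 * l, hl, by linarith, by convert hrot using 2 <;> ring⟩
      rcases le_or_gt (3 * a) l with h4 | h4
      · have h0 : 0 < l - 3 * a ∨ l = 3 * a := by omega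
        have hneg := hrot'.trans (associated_neg_mk _ _)
        -- On the excluded edge `l = 3a` the rotated point is `a φ²`; it is turned back to the
        -- included edge point `a`.
        rcases h0 with h0 | h0
        · exact ⟨l - 3 * a, a, h0, ha, by convert hneg using 2 <;> ring⟩
        · have ha' : 0 < a := by omega
          refine ⟨a, 0, ha', le_rfl, ?_⟩
          have h1 := (associated_rotate a 0).symm
          subst h0
          refine hneg.trans ?_
          convert h1 using 2 <;> ring
      -- Descent on `|a| + |b|`: multiplication by `φ²` lowers it when `3l < 2a`, by `φ⁻²` when `3a
      -- < 2l`. If neither holds, `a² - 3al + l²` is not positive.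
      · rcases lt_or_ge (3 * l) (2 * a) with h5 | h5
        · obtain ⟨c, d, hc, hd, hass⟩ := ih (l.natAbs + (a - 3 * l).natAbs) (by omega) l (a - 3 * l)
            (by nlinarith) rfl
          refine ⟨c, d, hc, hd, hrot.trans ?_⟩
          convert hass using 2 <;> ring
        · have h6 : 3 * a < 2 * l := by
            by_contra h6
            nlinarith
          obtain ⟨c, d, hc, hd, hass⟩ := ih ((3 * a - l).natAbs + (-a).natAbs) (by omega)
            (3 * a - l) (-a) (by nlinarith) rfl
          exact ⟨c, d, hc, hd, hrot'.trans hass⟩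

/-- Cone elements have positive norm, so the unit `m + k φ²` relating two of them has norm `1` and
inverse `(m + 3k) - k φ²`. If `k ≠ 0`, positivity of the coordinates contradicts this norm or the
cone conditions; if `k = 0`, the unit is `1`. -/
theorem cone_unique {a b c d : ℤ} (ha : 0 < a) (hb : 0 ≤ b) (hc : 0 < c) (hd : 0 ≤ d)
    (h : Associated (⟨a + b, b⟩ : GoldenInt) ⟨c + d, d⟩) : a = c ∧ b = d := by
  obtain ⟨u, hu⟩ := h
  have hun := isUnit_iff_natAbs_norm.1 u.isUnit
  obtain ⟨m, k, hmk⟩ : ∃ m k : ℤ, (u : GoldenInt) = ⟨m + k, k⟩ :=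
    ⟨(u : GoldenInt).re - (u : GoldenInt).im, (u : GoldenInt).im, by ext <;> simp⟩
  rw [hmk] at hu hun
  have e1 := congrArg QuadraticAlgebra.re hu
  have e2 := congrArg QuadraticAlgebra.im hu
  have e3 := congrArg QuadraticAlgebra.norm hu
  rw [map_mul] at e3
  simp only [norm_eq] at e3 hun
  simp only [re_mul, im_mul, one_mul] at e1 e2
  have f1 : c = m * a - k * b := by linear_combination e2 - e1
  have f2 : d = m * b + k * a + 3 * (k * b) := by linear_combination -e2
  have hn : m * m + 3 * (m * k) + k * k = 1 := by
    rcases Int.natAbs_eq_iff.1 hun with h | h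
    · push_cast at h; linarith
    · exfalso
      push_cast at h
      rw [h] at e3
      nlinarith [mul_nonneg ha.le hb, mul_nonneg hc.le hd, mul_pos ha ha, mul_pos hc hc,
        mul_nonneg hb hb, mul_nonneg hd hd]
  have g1 : a = (m + 3 * k) * c + k * d := by
    rw [f1, f2]; linear_combination (-a) * hn
  rcases lt_trichotomy k 0 with hk | rfl | hk
  · exfalso
    rcases lt_or_ge 0 m with hm | hm
    · have h3 : 0 < m + 3 * k := by
        by_contra h3
        nlinarith [mul_nonneg (neg_nonneg.2 hk.le) hd, mul_nonneg (neg_nonneg.2 (not_lt.1 h3)) hc.le]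
      nlinarith [mul_pos hm h3, mul_pos (neg_pos.2 hk) (neg_pos.2 hk)]
    · nlinarith [mul_nonneg (neg_nonneg.2 hm) hb, mul_pos (neg_pos.2 hk) ha,
        mul_nonneg (neg_nonneg.2 hk.le) hb]
  · have hm : m = 1 ∨ m = -1 := by
      have : m * m = 1 := by linarith
      exact mul_self_eq_one_iff.1 this
    rcases hm with rfl | rfl
    · constructor <;> linarith
    · exfalso; linarith
  · exfalso
    rcases lt_or_ge 0 m with hm | hm
    · nlinarith [mul_pos hm hk, mul_pos hm hm, mul_pos hk hk]
    · nlinarith [mul_nonneg (neg_nonneg.2 hm) ha.le, mul_nonneg hk.le hb]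

/-- The pairs `(r, b)` with `b < r` and `r ^ 2 + r b - b ^ 2 = N`. -/
def conePoints (N : ℕ) : Finset (ℕ × ℕ) :=
  (Finset.range (N + 1) ×ˢ Finset.range (N + 1)).filter
    fun x => x.2 < x.1 ∧ x.1 * x.1 + x.2 * (x.1 - x.2) = N

theorem mem_conePoints {N : ℕ} {x : ℕ × ℕ} :
    x ∈ conePoints N ↔ x.2 < x.1 ∧ x.1 * x.1 + x.2 * (x.1 - x.2) = N := by
  rw [conePoints, Finset.mem_filter, Finset.mem_product, Finset.mem_range, Finset.mem_range,
    and_iff_right_iff_imp]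
  rintro ⟨h1, h2⟩
  have : x.1 ≤ x.1 * x.1 := Nat.le_mul_self _
  constructor <;> omega

theorem classes_eq_image_conePoints {N : ℕ} (hN : N ≠ 0) :
    classes N = (fun x : ℕ × ℕ => Associates.mk (⟨x.1, x.2⟩ : GoldenInt)) '' conePoints N := by
  ext y
  constructor
  · rintro ⟨α, hα, rfl⟩
    obtain ⟨β, hβ, hβn⟩ : ∃ β : GoldenInt, Associated α β ∧ β.norm = N := by
      rcases Int.natAbs_eq_iff.1 hα with h | h
      · exact ⟨α, Associated.refl _, h⟩
      -- Multiplication by `φ`, of norm `-1`, corrects the sign of the norm.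
      · have hu : IsUnit (⟨0, 1⟩ : GoldenInt) := isUnit_iff_natAbs_norm.2 (by simp [norm_eq])
        refine ⟨α * ⟨0, 1⟩, (associated_mul_unit_left α _ hu).symm, ?_⟩
        rw [map_mul, h]
        simp [norm_eq]
    rw [norm_eq] at hβn
    have hpos : (0 : ℤ) < N := by exact_mod_cast Nat.pos_of_ne_zero hN
    obtain ⟨c, d, hc, hd, hass⟩ := exists_associated_cone (β.re - β.im) β.im (by nlinarith)
    have hass' := hβ.trans (by simpa using hass)
    have hn := natAbs_norm_eq_of_associated hass'
    rw [hα, norm_eq] at hn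
    lift c to ℕ using hc.le
    lift d to ℕ using hd
    refine ⟨(c + d, d), ?_, ?_⟩
    · rw [SetLike.mem_coe, mem_conePoints]
      refine ⟨by simpa using hc, ?_⟩
      rw [hn]
      zify
      rw [abs_of_nonneg (by nlinarith)]
      simp
      ring
    · rw [eq_comm, Associates.mk_eq_mk_iff_associated]
      simpa using hass'
  · rintro ⟨⟨r, b⟩, hx, rfl⟩
    rw [SetLike.mem_coe, mem_conePoints] at hx
    obtain ⟨h1, h2⟩ : b < r ∧ r * r + b * (r - b) = N := hx
    obtain ⟨a, rfl⟩ := Nat.exists_eq_add_of_lt h1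
    rw [mk_mem_classes, norm_eq, ← h2]
    zify
    rw [show b + a + 1 - b = a + 1 by omega]
    rw [abs_of_nonneg] <;> push_cast <;> nlinarith

theorem injOn_conePoints (N : ℕ) :
    Set.InjOn (fun x : ℕ × ℕ => Associates.mk (⟨x.1, x.2⟩ : GoldenInt)) (conePoints N) := by
  rintro ⟨r, b⟩ hx ⟨s, d⟩ hy h
  rw [SetLike.mem_coe, mem_conePoints] at hx hy
  have h1 : ((b : ℕ) : ℤ) < r := by exact_mod_cast hx.1
  have h2 : ((d : ℕ) : ℤ) < s := by exact_mod_cast hy.1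
  have := cone_unique (a := r - b) (b := b) (c := s - d) (d := d) (by linarith) (by positivity)
    (by linarith) (by positivity) (by simpa using Associates.mk_eq_mk_iff_associated.1 h)
  ext <;> simp <;> omega

theorem card_conePoints {N : ℕ} (hN : N ≠ 0) :
    ((conePoints N).card : ℤ) = ∑ d ∈ N.divisors, kroneckerSymbol 5 d := by
  have hfin : ∀ N, N ≠ 0 → (classes N).Finite := fun N hN => by
    rw [classes_eq_image_conePoints hN]
    exact (Finset.finite_toSet _).image _
  rw [← ncard_classes_eq_sum_divisors hfin hN, classes_eq_image_conePoints hN,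
    (injOn_conePoints N).ncard_image, Set.ncard_coe_finset]

end GoldenInt

/-! ### q-Pochhammer symbols and the cone polynomials -/

theorem qPochhammer_self_succ {R : Type*} [CommRing R] (q : R) (n : ℕ) :
    qPochhammer q q (n + 1) = qPochhammer q q n * (1 - q ^ (n + 1)) := by
  rw [qPochhammer, Finset.prod_range_succ, ← pow_succ']
  rfl

theorem qPochhammer_zero {R : Type*} [CommRing R] (a q : R) : qPochhammer a q 0 = 1 := by
  simp [qPochhammer]

/-- The polynomial `∑ b < r, q ^ (b (r - b))`. -/
def coneSum {R : Type*} [CommRing R] (q : R) (r : ℕ) : R :=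
  ∑ b ∈ Finset.range r, q ^ (b * (r - b))

/-- The two extreme terms give `1 + q^(r+1)`; for the others, `(b + 1)(r + 1 - b) = (r + 1) + b (r -
b)`. -/
theorem coneSum_add_two {R : Type*} [CommRing R] (q : R) (r : ℕ) :
    coneSum q (r + 2) = 1 + q ^ (r + 1) + q ^ (r + 1) * coneSum q r := by
  rw [coneSum, Finset.sum_range_succ', Finset.sum_range_succ, coneSum, Finset.mul_sum]
  have h : ∀ b ∈ Finset.range r, q ^ ((b + 1) * (r + 2 - (b + 1))) =
      q ^ (r + 1) * q ^ (b * (r - b)) := by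
    intro b hb
    obtain ⟨c, rfl⟩ := Nat.exists_eq_add_of_lt (Finset.mem_range.1 hb)
    rw [show b + c + 1 + 2 - (b + 1) = c + 2 by omega, show b + c + 1 - b = c + 1 by omega,
      ← pow_add]
    congr 1
    ring
  rw [Finset.sum_congr rfl h, show r + 2 - (r + 1) = 1 by omega]
  simp
  ring

theorem choose_succ_two (k : ℕ) : (k + 1).choose 2 = k.choose 2 + k := by
  rw [Nat.choose_succ_succ' k 1, Nat.choose_one_right, add_comm]

/-! ### The Bailey pair and the finite identity -/

section Field

variable {K : Type*} [Field K] {q : K}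

/-- The reciprocal `1 / (q; q)_k`, which vanishes for negative `k`. -/
def invPochhammer (q : K) (k : ℤ) : K :=
  if 0 ≤ k then (qPochhammer q q k.toNat)⁻¹ else 0

theorem invPochhammer_of_neg {k : ℤ} (hk : k < 0) : invPochhammer q k = 0 :=
  if_neg (not_le.2 hk)

theorem invPochhammer_natCast (k : ℕ) : invPochhammer q k = (qPochhammer q q k)⁻¹ := by
  simp [invPochhammer]

theorem qPochhammer_self_ne_zero (hq : ∀ k, k ≠ 0 → 1 - q ^ k ≠ 0) (n : ℕ) :
    qPochhammer q q n ≠ 0 := by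
  rw [qPochhammer, Finset.prod_ne_zero_iff]
  intro j _
  rw [← pow_succ']
  exact hq _ j.succ_ne_zero

/-- The value `0` at negative indices makes this hold for every integer `k`: at `k = 0` the factor
`1 - q^0` vanishes. Boundary terms of the telescoping sums thus need no separate treatment. -/
theorem invPochhammer_sub_one (hq : ∀ k, k ≠ 0 → 1 - q ^ k ≠ 0) (k : ℤ) :
    invPochhammer q (k - 1) = (1 - q ^ k) * invPochhammer q k := by
  rcases lt_trichotomy k 0 with hk | rfl | hk
  · rw [invPochhammer_of_neg hk, invPochhammer_of_neg (by linarith), mul_zero]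
  · rw [invPochhammer_of_neg (by norm_num)]
    simp
  · obtain ⟨m, rfl⟩ : ∃ m : ℕ, k = m + 1 := ⟨(k - 1).toNat, by omega⟩
    rw [add_sub_cancel_right, invPochhammer_natCast, ← Nat.cast_succ, invPochhammer_natCast,
      zpow_natCast, qPochhammer_self_succ]
    have := hq _ m.succ_ne_zero
    have := qPochhammer_self_ne_zero hq m
    field_simp

/-- A Bailey pair relative to `1`, with `β n = (q; q)_n / (q; q)_{2 n}` for `n > 0`. -/
theorem sum_coneSum_invPochhammer (hq0 : q ≠ 0) (hq : ∀ k, k ≠ 0 → 1 - q ^ k ≠ 0) {n : ℕ}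
    (hn : 1 ≤ n) :
    ∑ k ∈ Finset.range n, (-1) ^ k * (1 - q ^ (k + 1)) * q ^ (k + 1).choose 2 *
      invPochhammer q (n - (k + 1)) * invPochhammer q (n + (k + 1)) * coneSum q (k + 1) =
      qPochhammer q q n * invPochhammer q (2 * n) := by
  induction n, hn using Nat.le_induction with
  | base =>
    have h1 := invPochhammer_natCast (q := q) 0
    rw [Nat.cast_zero] at h1
    simp [h1, coneSum, qPochhammer, one_add_one_eq_two]
  | succ n hn ih =>
    have hXn := hq n (by omega)
    -- Telescoping certificate for the recursion in `n`. The multiplier `(1 + q^(n+1)) (1 -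
    -- q^(2n+1))` in `hstep` is `β_n / β_{n+1}`; the last term of `V` absorbs the inhomogeneous part
    -- of `coneSum_add_two`.
    let V : ℕ → K := fun k =>
      (-1) ^ k * q ^ (n + k.choose 2) * invPochhammer q (n - k) * invPochhammer q (n + k) *
        coneSum q (k + 1) -
      (-1) ^ k * q ^ (n + (k + 1).choose 2) * invPochhammer q (n - k - 1) *
        invPochhammer q (n + k + 1) * coneSum q (k + 2) +
      (-1) ^ k * q ^ (n + (k + 2).choose 2) * invPochhammer q (n - k - 1 - 1) *
        invPochhammer q (n + k + 1) / (1 - q ^ n)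
    have hstep : ∀ k ∈ Finset.range (n + 1),
        (1 + q ^ (n + 1)) * (1 - q ^ (2 * n + 1)) *
          ((-1) ^ k * (1 - q ^ (k + 1)) * q ^ (k + 1).choose 2 *
            invPochhammer q ((n + 1 : ℕ) - (k + 1)) * invPochhammer q ((n + 1 : ℕ) + (k + 1)) *
            coneSum q (k + 1)) -
          (-1) ^ k * (1 - q ^ (k + 1)) * q ^ (k + 1).choose 2 *
            invPochhammer q (n - (k + 1)) * invPochhammer q (n + (k + 1)) * coneSum q (k + 1) =
        V k - V (k + 1) := by
      intro k _
      have a1 := invPochhammer_sub_one hq (n - k)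
      have a2 := invPochhammer_sub_one hq (n - k - 1)
      have a3 := invPochhammer_sub_one hq (n - k - 1 - 1)
      have b1 := invPochhammer_sub_one hq (n + k + 2)
      have b2 := invPochhammer_sub_one hq (n + k + 1)
      rw [show (n + k + 2 - 1 : ℤ) = n + k + 1 by ring] at b1
      rw [show (n + k + 1 - 1 : ℤ) = n + k by ring] at b2
      simp only [V]
      push_cast
      rw [show (n + 1 - (k + 1) : ℤ) = n - k by ring,
        show (n + 1 + (k + 1) : ℤ) = n + k + 2 by ring,
        show (n - (k + 1) : ℤ) = n - k - 1 by ring,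
        show (n + (k + 1) : ℤ) = n + k + 1 by ring,
        show (n + k + 1 + 1 : ℤ) = n + k + 2 by ring,
        show k + 1 + 2 = k + 1 + 1 + 1 by ring, show k + 1 + 1 + 1 = k + 1 + 2 by ring,
        coneSum_add_two q (k + 1), a3, a2, a1, b2, b1]
      simp only [show k + 1 + 2 = k + 1 + 1 + 1 by ring, show k + 2 = k + 1 + 1 by ring,
        choose_succ_two]
      simp only [zpow_sub₀ hq0, zpow_add₀ hq0, zpow_natCast, zpow_ofNat]
      simp only [pow_add, pow_one]
      generalize q ^ k.choose 2 = Z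
      generalize coneSum q (k + 1) = P
      generalize coneSum q (k + 1 + 1) = P'
      generalize invPochhammer q _ = A
      generalize invPochhammer q _ = B
      have hY : q ^ k ≠ 0 := pow_ne_zero _ hq0
      generalize q ^ k = Y at *
      rw [two_mul n, pow_add q n n]
      generalize q ^ n = X at *
      generalize (-1 : K) ^ k = s
      field_simp
      ring
    have hsum := Finset.sum_congr rfl hstep
    rw [Finset.sum_range_sub', Finset.sum_sub_distrib, ← Finset.mul_sum] at hsum
    have hV0 : V 0 = 0 := by
      have a1 := invPochhammer_sub_one hq n
      have a2 := invPochhammer_sub_one hq (n - 1)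
      have b1 := invPochhammer_sub_one hq (n + 1)
      rw [add_sub_cancel_right] at b1
      simp only [V, Nat.cast_zero, sub_zero, add_zero, a2, a1, b1]
      simp only [zpow_sub₀ hq0, zpow_add₀ hq0, zpow_natCast, zpow_one]
      simp [coneSum, Finset.sum_range_succ]
      field_simp
      ring
    have hVn : V (n + 1) = 0 := by
      simp only [V]
      rw [invPochhammer_of_neg (k := n - (n + 1 : ℕ)) (by push_cast; linarith),
        invPochhammer_of_neg (k := n - (n + 1 : ℕ) - 1) (by push_cast; linarith),
        invPochhammer_of_neg (k := n - (n + 1 : ℕ) - 1 - 1) (by push_cast; linarith)]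
      simp
    have hlast : ∑ k ∈ Finset.range (n + 1), (-1) ^ k * (1 - q ^ (k + 1)) * q ^ (k + 1).choose 2 *
        invPochhammer q (n - (k + 1)) * invPochhammer q (n + (k + 1)) * coneSum q (k + 1) =
        qPochhammer q q n * invPochhammer q (2 * n) := by
      rw [Finset.sum_range_succ, ih, invPochhammer_of_neg (k := n - (n + 1)) (by linarith)]
      simp
    rw [hV0, hVn, hlast, sub_zero] at hsum
    have hx := hq (2 * n + 1) (by omega)
    have hy := hq (2 * (n + 1)) (by omega)
    have hyf : 1 - q ^ (2 * (n + 1)) = (1 - q ^ (n + 1)) * (1 + q ^ (n + 1)) := by ring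
    have hx' : 1 + q ^ (n + 1) ≠ 0 := right_ne_zero_of_mul (hyf ▸ hy)
    have c1 := invPochhammer_sub_one hq (2 * (n + 1 : ℕ))
    have c2 := invPochhammer_sub_one hq (2 * (n + 1 : ℕ) - 1)
    rw [show (2 * (n + 1 : ℕ) - 1 - 1 : ℤ) = 2 * n by push_cast; ring, c1,
      show (2 * (n + 1 : ℕ) - 1 : ℤ) = (2 * n + 1 : ℕ) by push_cast; ring, zpow_natCast,
      show (2 * (n + 1 : ℕ) : ℤ) = (2 * (n + 1) : ℕ) by push_cast; ring, zpow_natCast, hyf] at c2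
    apply mul_left_cancel₀ (mul_ne_zero hx' hx)
    rw [sub_eq_zero.1 hsum, c2, qPochhammer_self_succ]
    push_cast
    ring

/-- With `n + 1` and `r + 1` as the true indices, this is a terminating q-Gauss (q-Chu–Vandermonde)
sum. It is proved by induction on `N`; at `N = r + 1` only the term `n = r` survives. -/
theorem sum_pochhammer_kernel (hq0 : q ≠ 0) (hq : ∀ k, k ≠ 0 → 1 - q ^ k ≠ 0) (r : ℕ) {N : ℕ}
    (hN : r + 1 ≤ N) :
    (1 - q ^ (r + 1)) * ∑ n ∈ Finset.range N, (-1) ^ n * q ^ (n + 2).choose 2 * qPochhammer q q n *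
      invPochhammer q (N - (n + 1)) * invPochhammer q (n - r) * invPochhammer q (n + r + 2) =
      (-1) ^ r * q ^ (r + 2).choose 2 * qPochhammer q q N * invPochhammer q (N - (r + 1)) *
        invPochhammer q (N + (r + 1)) := by
  induction N, hN using Nat.le_induction with
  | base =>
    rw [Finset.sum_range_succ, Finset.sum_eq_zero, zero_add, qPochhammer_self_succ]
    · push_cast
      simp only [sub_self]
      have h1 := invPochhammer_natCast (q := q) 0
      rw [Nat.cast_zero, qPochhammer_zero, inv_one] at h1
      rw [h1, show (r + 1 + (r + 1) : ℤ) = r + r + 2 by ring]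
      ring
    · intro n hn
      rw [invPochhammer_of_neg (k := n - r)]
      · simp
      · have := Finset.mem_range.1 hn
        omega
  | succ N hN ih =>
    -- Telescoping certificate for the first-order recursion in `N`; it vanishes at both ends
    -- because a reciprocal has negative index there.
    let G : ℕ → K := fun n =>
      -((-1) ^ n * q ^ (N + 1 + (n + 1).choose 2) * qPochhammer q q n * invPochhammer q (N - n) *
        invPochhammer q (n - r - 1) * invPochhammer q (n + r + 1))
    have hstep : ∀ n ∈ Finset.range (N + 1),
        (1 - q ^ (N - r)) * (1 - q ^ (N + r + 2)) *
          ((-1) ^ n * q ^ (n + 2).choose 2 * qPochhammer q q n *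
            invPochhammer q ((N + 1 : ℕ) - (n + 1)) * invPochhammer q (n - r) *
            invPochhammer q (n + r + 2)) -
          (1 - q ^ (N + 1)) *
          ((-1) ^ n * q ^ (n + 2).choose 2 * qPochhammer q q n *
            invPochhammer q (N - (n + 1)) * invPochhammer q (n - r) *
            invPochhammer q (n + r + 2)) = G (n + 1) - G n := by
      intro n _
      have a1 := invPochhammer_sub_one hq (N - n)
      have a2 := invPochhammer_sub_one hq (n - r)
      have a3 := invPochhammer_sub_one hq (n + r + 2)
      rw [show (n + r + 2 - 1 : ℤ) = n + r + 1 by ring] at a3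
      simp only [G]
      push_cast
      rw [show (N + 1 - (n + 1) : ℤ) = N - n by ring,
        show (N - (n + 1) : ℤ) = N - n - 1 by ring,
        show (n + 1 - r - 1 : ℤ) = n - r by ring,
        show (n + 1 + r + 1 : ℤ) = n + r + 2 by ring, a1, a2, a3, qPochhammer_self_succ]
      simp only [show n + 2 = n + 1 + 1 by ring, choose_succ_two]
      have hNr : q ^ (N - r) = q ^ N / q ^ r := by
        rw [eq_div_iff (pow_ne_zero _ hq0), ← pow_add]
        congr 1
        omega
      rw [hNr]
      simp only [zpow_sub₀ hq0, zpow_add₀ hq0, zpow_natCast, zpow_ofNat]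
      simp only [pow_add, pow_one]
      generalize q ^ n.choose 2 = Z
      generalize invPochhammer q _ = A
      generalize invPochhammer q _ = B
      generalize invPochhammer q _ = C
      generalize qPochhammer q q n = D
      have hY : q ^ n ≠ 0 := pow_ne_zero _ hq0
      have hZ : q ^ r ≠ 0 := pow_ne_zero _ hq0
      generalize q ^ n = Y at *
      generalize q ^ r = W at *
      generalize q ^ N = X at *
      generalize (-1 : K) ^ n = s
      field_simp
      ring
    have hsum := Finset.sum_congr rfl hstep
    rw [Finset.sum_range_sub, Finset.sum_sub_distrib, ← Finset.mul_sum, ← Finset.mul_sum] at hsum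
    have hG0 : G 0 = 0 := by
      simp only [G]
      rw [invPochhammer_of_neg (k := (0 : ℕ) - r - 1) (by push_cast; linarith)]
      simp
    have hGN : G (N + 1) = 0 := by
      simp only [G]
      rw [invPochhammer_of_neg (k := N - (N + 1 : ℕ)) (by push_cast; linarith)]
      simp
    have hlast : ∑ n ∈ Finset.range (N + 1), (-1) ^ n * q ^ (n + 2).choose 2 * qPochhammer q q n *
        invPochhammer q (N - (n + 1)) * invPochhammer q (n - r) * invPochhammer q (n + r + 2) =
        ∑ n ∈ Finset.range N, (-1) ^ n * q ^ (n + 2).choose 2 * qPochhammer q q n *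
        invPochhammer q (N - (n + 1)) * invPochhammer q (n - r) * invPochhammer q (n + r + 2) := by
      rw [Finset.sum_range_succ, invPochhammer_of_neg (k := N - (N + 1)) (by linarith)]
      simp
    rw [hG0, hGN, hlast, sub_zero] at hsum
    have h1 := hq (N - r) (by omega)
    have h2 := hq (N + r + 2) (by omega)
    have a1 := invPochhammer_sub_one hq (N - r)
    have a2 := invPochhammer_sub_one hq (N + r + 2)
    rw [show (N - r - 1 : ℤ) = N - (r + 1) by ring,
      show (N - r : ℤ) = (N - r : ℕ) by push_cast [show r ≤ N by omega]; ring, zpow_natCast] at a1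
    rw [show (N + r + 2 - 1 : ℤ) = N + (r + 1) by ring,
      show (N + r + 2 : ℤ) = (N + r + 2 : ℕ) by push_cast; ring, zpow_natCast] at a2
    rw [a1, a2] at ih
    apply mul_left_cancel₀ (mul_ne_zero h1 h2)
    rw [mul_left_comm, sub_eq_zero.1 hsum, mul_left_comm, ih, qPochhammer_self_succ,
      show ((N + 1 : ℕ) - (r + 1) : ℤ) = (N - r : ℕ) by push_cast [show r ≤ N by omega]; ring,
      show ((N + 1 : ℕ) + (r + 1) : ℤ) = (N + r + 2 : ℕ) by push_cast; ring]
    ring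

/-- A finite form of the expansion of the series over the cone `0 ≤ b < r`. -/
theorem sum_pochhammer_eq_sum_coneSum (hq0 : q ≠ 0) (hq : ∀ k, k ≠ 0 → 1 - q ^ k ≠ 0) (N : ℕ) :
    ∑ n ∈ Finset.range N, (-1) ^ n * q ^ (n + 2).choose 2 * qPochhammer q q (n + 1) *
      qPochhammer q q n / qPochhammer q q (2 * (n + 1)) *
      (qPochhammer q q N / qPochhammer q q (N - (n + 1))) =
    ∑ r ∈ Finset.range N, q ^ ((r + 1) * (r + 1)) * coneSum q (r + 1) *
      (qPochhammer q q N / qPochhammer q q (N - (r + 1)) *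
        (qPochhammer q q N / qPochhammer q q (N + (r + 1)))) := by
  have hinv : ∀ n ∈ Finset.range N, (qPochhammer q q (N - (n + 1)))⁻¹ =
      invPochhammer q (N - (n + 1)) := by
    intro n hn
    rw [← invPochhammer_natCast, Nat.cast_sub (Finset.mem_range.1 hn)]
    push_cast
    rfl
  have hleft : ∀ n ∈ Finset.range N,
      (-1) ^ n * q ^ (n + 2).choose 2 * qPochhammer q q (n + 1) *
      qPochhammer q q n / qPochhammer q q (2 * (n + 1)) *
      (qPochhammer q q N / qPochhammer q q (N - (n + 1))) =
      ∑ r ∈ Finset.range N, ((-1) ^ n * q ^ (n + 2).choose 2 * qPochhammer q q n *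
        invPochhammer q (N - (n + 1)) * invPochhammer q (n - r) * invPochhammer q (n + r + 2)) *
        (qPochhammer q q N * (-1) ^ r * (1 - q ^ (r + 1)) * q ^ (r + 1).choose 2 *
          coneSum q (r + 1)) := by
    intro n hn
    have h1 := sum_coneSum_invPochhammer hq0 hq (n := n + 1) (by omega)
    have h2 := invPochhammer_natCast (q := q) (2 * (n + 1))
    push_cast at h1 h2
    rw [h2] at h1
    rw [div_eq_mul_inv, div_eq_mul_inv, hinv n hn,
      show (-1) ^ n * q ^ (n + 2).choose 2 * qPochhammer q q (n + 1) *
        qPochhammer q q n * (qPochhammer q q (2 * (n + 1)))⁻¹ *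
        (qPochhammer q q N * invPochhammer q (N - (n + 1))) =
        (-1) ^ n * q ^ (n + 2).choose 2 * qPochhammer q q n *
        (qPochhammer q q N * invPochhammer q (N - (n + 1))) *
        (qPochhammer q q (n + 1) * (qPochhammer q q (2 * (n + 1)))⁻¹) by ring, ← h1, Finset.mul_sum]
    -- The Bailey sum stops at `r = n`, but its terms vanish beyond, so the range can be made
    -- independent of `n` before the sums are interchanged.
    have hsub : Finset.range (n + 1) ⊆ Finset.range N :=
      Finset.range_subset_range.2 (Finset.mem_range.1 hn)
    rw [← Finset.sum_subset hsub]
    · refine Finset.sum_congr rfl fun r _ => ?_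
      rw [show (n + 1 - (r + 1) : ℤ) = n - r by ring,
        show (n + 1 + (r + 1) : ℤ) = n + r + 2 by ring]
      ring
    · intro r _ hr
      rw [Finset.mem_range, not_lt] at hr
      rw [invPochhammer_of_neg (k := n - r) (by omega)]
      simp
  rw [Finset.sum_congr rfl hleft, Finset.sum_comm]
  refine Finset.sum_congr rfl fun r hr => ?_
  have h1 := sum_pochhammer_kernel hq0 hq r (N := N) (Finset.mem_range.1 hr)
  have h2 := invPochhammer_natCast (q := q) (N + (r + 1))
  push_cast at h2
  rw [h2] at h1
  rw [← Finset.sum_mul, div_eq_mul_inv, div_eq_mul_inv, hinv r hr,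
    show (r + 1) * (r + 1) = (r + 1).choose 2 + (r + 2).choose 2 by
      have h3 := Nat.choose_two_right (r + 1)
      have h4 := choose_succ_two (r + 1)
      have h5 := Nat.triangle_succ r
      have h6 := Nat.div_mul_cancel (even_iff_two_dvd.1 (Nat.even_mul_pred_self (r + 1)))
      rw [add_tsub_cancel_right] at h3 h6
      nlinarith, pow_add]
  have hs : ((-1 : K) ^ r) * (-1) ^ r = 1 := by rw [← mul_pow]; simp
  linear_combination (qPochhammer q q N * (-1) ^ r * q ^ (r + 1).choose 2 *
          coneSum q (r + 1)) * h1 + q ^ (r + 1).choose 2 * q ^ (r + 2).choose 2 *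
          coneSum q (r + 1) * qPochhammer q q N * qPochhammer q q N *
          invPochhammer q (N - (r + 1)) * (qPochhammer q q (N + (r + 1)))⁻¹ * hs

end Field

theorem card_conePoints_eq_sum (N : ℕ) :
    (GoldenInt.conePoints N).card = ∑ r ∈ Finset.range N, ∑ b ∈ Finset.range (r + 1),
      if (r + 1) * (r + 1) + b * (r + 1 - b) = N then 1 else 0 := by
  simp_rw [← Finset.card_filter]
  rw [← Finset.card_sigma]
  refine Finset.card_bij' (fun x _ => ⟨x.1 - 1, x.2⟩) (fun x _ => (x.1 + 1, x.2)) ?_ ?_ ?_ ?_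
  · rintro ⟨r, b⟩ hx
    rw [GoldenInt.mem_conePoints] at hx
    obtain ⟨a, rfl⟩ : ∃ a, r = b + a + 1 := Nat.exists_eq_add_of_lt hx.1
    simp only [add_tsub_cancel_right, Finset.mem_sigma, Finset.mem_range, Finset.mem_filter]
    have := hx.2
    dsimp only at this
    refine ⟨?_, by omega, this⟩
    rw [← this]
    nlinarith [Nat.zero_le (b * (b + a + 1 - b))]
  · rintro ⟨r, b⟩ hx
    rw [Finset.mem_sigma, Finset.mem_filter, Finset.mem_range, Finset.mem_range] at hx
    rw [GoldenInt.mem_conePoints]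
    exact hx.2
  · rintro ⟨r, b⟩ hx
    rw [GoldenInt.mem_conePoints] at hx
    have := hx.1
    ext <;> simp at * <;> omega
  · rintro ⟨r, b⟩ hx
    simp

/-! ### The identity of formal power series -/

section PowerSeries

open PowerSeries

theorem qPochhammer_mul_invOfUnit (n : ℕ) :
    qPochhammer (X : ℤ⟦X⟧) X n * invOfUnit (qPochhammer X X n) 1 = 1 :=
  mul_invOfUnit _ _ (by rw [constantCoeff_qPochhammer_X]; rfl)

/-- The field identity is applied in the fraction field of `ℤ⟦X⟧` and pulled back along the
injective embedding. -/
theorem sum_pochhammer_eq_sum_coneSum_powerSeries (N : ℕ) :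
    ∑ n ∈ Finset.range N, (-1) ^ n * (X : ℤ⟦X⟧) ^ (n + 2).choose 2 * qPochhammer X X (n + 1) *
      qPochhammer X X n * invOfUnit (qPochhammer X X (2 * (n + 1))) 1 *
      (qPochhammer X X N * invOfUnit (qPochhammer X X (N - (n + 1))) 1) =
    ∑ r ∈ Finset.range N, X ^ ((r + 1) * (r + 1)) * coneSum X (r + 1) *
      (qPochhammer X X N * invOfUnit (qPochhammer X X (N - (r + 1))) 1 *
        (qPochhammer X X N * invOfUnit (qPochhammer X X (N + (r + 1))) 1)) := by
  set φ : ℤ⟦X⟧ →+* FractionRing ℤ⟦X⟧ := algebraMap _ _ with hφ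
  have hinj : Function.Injective φ := IsFractionRing.injective _ _
  have hpoch : ∀ n, φ (qPochhammer X X n) = qPochhammer (φ X) (φ X) n := fun n => by
    simp [qPochhammer, map_prod]
  have hcone : ∀ n, φ (coneSum X n) = coneSum (φ X) n := fun n => by
    simp [coneSum, map_sum]
  have hinv : ∀ n, φ (invOfUnit (qPochhammer X X n) 1) = (qPochhammer (φ X) (φ X) n)⁻¹ := by
    intro n
    rw [← hpoch]
    apply eq_inv_of_mul_eq_one_right
    rw [← map_mul, qPochhammer_mul_invOfUnit, map_one]
  have h := sum_pochhammer_eq_sum_coneSum (q := φ X)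
    ((map_ne_zero_iff φ hinj).2 X_ne_zero) (fun k hk => by
      rw [← map_pow, ← map_one φ, ← map_sub, map_ne_zero_iff φ hinj]
      intro h
      have := congrArg (constantCoeff (R := ℤ)) h
      simp [hk] at this) N
  apply hinj
  simp only [map_sum, map_mul, map_pow, map_neg, map_one, hpoch, hcone, hinv]
  simpa only [div_eq_mul_inv] using h

theorem X_pow_dvd_qPochhammer_sub {m n : ℕ} (h : m ≤ n) :
    (X : ℤ⟦X⟧) ^ (m + 1) ∣ qPochhammer X X n - qPochhammer X X m := by
  induction n, h using Nat.le_induction with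
  | base => simp
  | succ n hn ih =>
    rw [qPochhammer_self_succ, show qPochhammer X X n * (1 - (X : ℤ⟦X⟧) ^ (n + 1)) -
      qPochhammer X X m = (qPochhammer X X n - qPochhammer X X m) -
        X ^ (n + 1) * qPochhammer X X n by ring]
    exact dvd_sub ih ((pow_dvd_pow _ (by omega)).mul_right _)

theorem X_pow_dvd_qPochhammer_mul_inv_sub_one {m n k : ℕ} (hm : k ≤ m) (hn : k ≤ n) :
    (X : ℤ⟦X⟧) ^ (k + 1) ∣ qPochhammer X X n * invOfUnit (qPochhammer X X m) 1 - 1 := by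
  rw [← qPochhammer_mul_invOfUnit m, ← sub_mul]
  refine Dvd.dvd.mul_right ?_ _
  have := dvd_sub (X_pow_dvd_qPochhammer_sub hn) (X_pow_dvd_qPochhammer_sub hm)
  simpa using this

theorem succ_le_choose_two (n : ℕ) : n + 1 ≤ (n + 2).choose 2 := by
  have h1 := choose_succ_two (n + 1)
  rw [show n + 1 + 1 = n + 2 from rfl] at h1
  omega

/-- The finite identity at `N = k` already determines the coefficient of `X^k`, because all its
weights can be replaced by `1` modulo `X^(k+1)`. -/
theorem coeff_sum_pochhammer (k : ℕ) :
    coeff k (∑ n ∈ Finset.range k, (-1 : ℤ⟦X⟧) ^ n * (X : ℤ⟦X⟧) ^ (n + 2).choose 2 *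
      qPochhammer (X : ℤ⟦X⟧) X (n + 1) * qPochhammer (X : ℤ⟦X⟧) X n *
      invOfUnit (qPochhammer (X : ℤ⟦X⟧) X (2 * (n + 1))) 1) = (GoldenInt.conePoints k).card := by
  have h1 : (X : ℤ⟦X⟧) ^ (k + 1) ∣
      ∑ n ∈ Finset.range k, (-1 : ℤ⟦X⟧) ^ n * (X : ℤ⟦X⟧) ^ (n + 2).choose 2 *
        qPochhammer X X (n + 1) * qPochhammer X X n *
        invOfUnit (qPochhammer X X (2 * (n + 1))) 1 -
      ∑ r ∈ Finset.range k, X ^ ((r + 1) * (r + 1)) * coneSum X (r + 1) := by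
    have h2 := sum_pochhammer_eq_sum_coneSum_powerSeries k
    rw [← sub_eq_zero] at h2
    rw [← sub_zero (_ - _), ← h2, sub_sub_sub_comm, ← Finset.sum_sub_distrib,
      ← Finset.sum_sub_distrib]
    -- A weight of index `n` is `1` modulo `X^(k-n)`, and its term carries a power of `X` with
    -- exponent at least `n + 1`; together they give `X^(k+1)`. The same holds for `r`.
    refine dvd_sub (Finset.dvd_sum fun n hn => ?_) (Finset.dvd_sum fun r hr => ?_)
    · rw [Finset.mem_range] at hn
      obtain ⟨a, ha⟩ := X_pow_dvd_qPochhammer_mul_inv_sub_one (k := k - (n + 1)) (m := k - (n + 1))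
        (n := k) le_rfl (by omega)
      refine (pow_dvd_pow X (?_ : k + 1 ≤ (n + 2).choose 2 + (k - (n + 1) + 1))).trans ?_
      · have := succ_le_choose_two n
        omega
      · rw [sub_eq_iff_eq_add] at ha
        rw [ha, pow_add]
        exact ⟨-((-1) ^ n * qPochhammer X X (n + 1) * qPochhammer X X n *
          invOfUnit (qPochhammer X X (2 * (n + 1))) 1 * a), by ring⟩
    · rw [Finset.mem_range] at hr
      obtain ⟨a, ha⟩ := X_pow_dvd_qPochhammer_mul_inv_sub_one (k := k - (r + 1)) (m := k - (r + 1))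
        (n := k) le_rfl (by omega)
      obtain ⟨b, hb⟩ := X_pow_dvd_qPochhammer_mul_inv_sub_one (k := k - (r + 1)) (m := k + (r + 1))
        (n := k) (by omega) (by omega)
      refine (pow_dvd_pow X (?_ : k + 1 ≤ (r + 1) * (r + 1) + (k - (r + 1) + 1))).trans ?_
      · have : r + 1 ≤ (r + 1) * (r + 1) := Nat.le_mul_self _
        omega
      · rw [sub_eq_iff_eq_add] at ha hb
        rw [ha, hb, pow_add]
        exact ⟨-(coneSum X (r + 1) * (a + b + X ^ (k - (r + 1) + 1) * a * b)), by ring⟩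
  rw [X_pow_dvd_iff] at h1
  have h3 := h1 k (by omega)
  rw [map_sub, sub_eq_zero] at h3
  rw [h3, card_conePoints_eq_sum, map_sum]
  push_cast
  refine Finset.sum_congr rfl fun r _ => ?_
  rw [coneSum, Finset.mul_sum, map_sum]
  refine Finset.sum_congr rfl fun b _ => ?_
  rw [← pow_add, coeff_X_pow]
  simp [eq_comm]

theorem invOfUnit_one_sub_X_pow {m : ℕ} (hm : m ≠ 0) :
    invOfUnit (1 - (X : ℤ⟦X⟧) ^ m) 1 = mk fun j => if m ∣ j then 1 else 0 := by
  have h1 : (1 - (X : ℤ⟦X⟧) ^ m) * invOfUnit (1 - (X : ℤ⟦X⟧) ^ m) 1 = 1 :=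
    mul_invOfUnit _ _ (by simp [hm])
  have h2 : (1 - (X : ℤ⟦X⟧) ^ m) * (mk fun j => if m ∣ j then 1 else 0) = 1 := by
    ext j
    rw [sub_mul, one_mul, map_sub, coeff_X_pow_mul', coeff_mk, coeff_one]
    by_cases hj : m ≤ j
    · rw [if_pos hj, coeff_mk, if_neg (by omega : j ≠ 0)]
      simp [Nat.dvd_sub_iff_left hj dvd_rfl]
    · rw [if_neg hj, sub_zero]
      by_cases hj0 : j = 0
      · simp [hj0]
      · rw [if_neg hj0, if_neg (fun h => hj (Nat.le_of_dvd (Nat.pos_of_ne_zero hj0) h))]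
  have h3 : (1 - (X : ℤ⟦X⟧) ^ m) ≠ 0 := left_ne_zero_of_mul_eq_one h1
  exact mul_left_cancel₀ h3 (h1.trans h2.symm)

theorem coeff_lambert (c : ℤ) (n k : ℕ) :
    coeff k ((c : ℤ⟦X⟧) * X ^ (n + 1) * invOfUnit (1 - X ^ (n + 1)) 1) =
      if k ≠ 0 ∧ n + 1 ∣ k then c else 0 := by
  rw [invOfUnit_one_sub_X_pow n.succ_ne_zero, mul_assoc, ← eq_intCast (C (R := ℤ)) c, coeff_C_mul,
    coeff_X_pow_mul']
  by_cases h : n + 1 ≤ k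
  · rw [if_pos h, coeff_mk]
    simp [Nat.dvd_sub_iff_left h dvd_rfl, show k ≠ 0 by omega]
  · rw [if_neg h, if_neg, mul_zero]
    exact fun h' => h (Nat.le_of_dvd (Nat.pos_of_ne_zero h'.1) h'.2)

theorem sum_range_ite_dvd {k : ℕ} (hk : k ≠ 0) (f : ℕ → ℤ) :
    ∑ n ∈ Finset.range k, (if k ≠ 0 ∧ n + 1 ∣ k then f (n + 1) else 0) =
      ∑ d ∈ k.divisors, f d := by
  rw [Finset.range_eq_Ico, Finset.sum_Ico_add' (fun n => if k ≠ 0 ∧ n ∣ k then f n else 0),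
    ← Finset.sum_filter]
  refine Finset.sum_congr ?_ fun _ _ => rfl
  ext d
  simp only [Finset.mem_filter, Finset.mem_Ico, Nat.mem_divisors]
  refine ⟨fun h => ⟨h.2.2, hk⟩, fun h => ⟨⟨?_, ?_⟩, hk, h.1⟩⟩
  · have := Nat.pos_of_dvd_of_pos h.1 (Nat.pos_of_ne_zero hk)
    omega
  · have := Nat.le_of_dvd (Nat.pos_of_ne_zero hk) h.1
    omega

theorem hasSum_lambert_powerSeries :
    HasSum (fun n : ℕ => (kroneckerSymbol 5 (n + 1) : ℤ⟦X⟧) * X ^ (n + 1) *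
      invOfUnit (1 - X ^ (n + 1)) 1) (mk fun k => ((GoldenInt.conePoints k).card : ℤ)) := by
  rw [WithPiTopology.hasSum_iff_hasSum_coeff]
  intro k
  simp_rw [coeff_lambert]
  rw [coeff_mk]
  rcases eq_or_ne k 0 with rfl | hk
  · have h0 : GoldenInt.conePoints 0 = ∅ := by decide
    simp [h0, hasSum_zero]
  · rw [GoldenInt.card_conePoints hk, ← sum_range_ite_dvd hk]
    refine hasSum_sum_of_ne_finset_zero fun n hn => if_neg fun h => hn ?_
    have := Nat.le_of_dvd (Nat.pos_of_ne_zero hk) h.2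
    rw [Finset.mem_range]
    omega

theorem hasSum_pochhammer_powerSeries :
    HasSum (fun n : ℕ => (-1) ^ n * (X : ℤ⟦X⟧) ^ (n + 2).choose 2 *
      qPochhammer X X (n + 1) * qPochhammer X X n *
      invOfUnit (qPochhammer X X (2 * (n + 1))) 1)
      (mk fun k => ((GoldenInt.conePoints k).card : ℤ)) := by
  rw [WithPiTopology.hasSum_iff_hasSum_coeff]
  intro k
  rw [coeff_mk, ← coeff_sum_pochhammer, map_sum]
  refine hasSum_sum_of_ne_finset_zero fun n hn => ?_
  rw [Finset.mem_range, not_lt] at hn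
  refine X_pow_dvd_iff.1 (?_ : X ^ (k + 1) ∣ _) k (by omega)
  have : (X : ℤ⟦X⟧) ^ (k + 1) ∣ X ^ (n + 2).choose 2 :=
    pow_dvd_pow _ (by have := succ_le_choose_two n; omega)
  exact (((this.mul_left _).mul_right _).mul_right _).mul_right _

end PowerSeries

/-! ### The identity for complex `q` in the unit disc -/

section Complex

open Filter Topology

theorem abs_kroneckerSymbol_le_one (a : ℤ) {n : ℕ} (hn : n ≠ 0) : |kroneckerSymbol a n| ≤ 1 := by
  rw [kroneckerSymbol, if_neg hn, abs_mul, abs_pow]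
  have h1 : |ZMod.χ₈ (a : ZMod 8)| ≤ 1 := by
    generalize (a : ZMod 8) = x
    revert x
    decide
  have h2 : |jacobiSym a (n / 2 ^ n.factorization 2)| ≤ 1 := by
    rcases jacobiSym.trichotomy a (n / 2 ^ n.factorization 2) with h | h | h <;> simp [h]
  exact mul_le_one₀ (pow_le_one₀ (abs_nonneg _) h1) (abs_nonneg _) h2

theorem hasSum_of_eq {ι : Type*} {f g : ι → ℂ} {a : ℂ} (h : HasSum g a) (hfg : ∀ i, f i = g i) :
    HasSum f a :=
  funext hfg ▸ h

variable {q : ℂ}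

theorem one_sub_pow_ne_zero (hq : ‖q‖ < 1) {k : ℕ} (hk : k ≠ 0) : 1 - q ^ k ≠ 0 := by
  rw [sub_ne_zero]
  intro h
  have := congrArg norm h
  rw [norm_one, norm_pow] at this
  exact (pow_lt_one₀ (norm_nonneg q) hq hk).ne this.symm

theorem exists_tendsto_qPochhammer (hq : ‖q‖ < 1) :
    ∃ L : ℂ, L ≠ 0 ∧ Tendsto (qPochhammer q q) atTop (𝓝 L) := by
  have hsum : Summable fun n : ℕ => ‖-(q ^ (n + 1))‖ := by
    simp_rw [norm_neg, norm_pow]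
    exact (summable_nat_add_iff 1).2 (summable_geometric_of_lt_one (norm_nonneg q) hq)
  refine ⟨∏' n : ℕ, (1 + -(q ^ (n + 1))), ?_, ?_⟩
  · refine tprod_one_add_ne_zero_of_summable (fun n => ?_) hsum
    rw [← sub_eq_add_neg]
    exact one_sub_pow_ne_zero hq n.succ_ne_zero
  · refine ((multipliable_one_add_of_summable hsum).hasProd.tendsto_prod_nat).congr fun n => ?_
    rw [qPochhammer]
    exact Finset.prod_congr rfl fun j _ => by rw [pow_succ']; ring

/-- Convergence to a nonzero limit bounds the symbols and their inverses uniformly, which supplies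
the dominating constants for the limit. -/
theorem exists_norm_qPochhammer_le (hq : ‖q‖ < 1) :
    ∃ C : ℝ, ∀ n, ‖qPochhammer q q n‖ ≤ C ∧ ‖(qPochhammer q q n)⁻¹‖ ≤ C := by
  obtain ⟨L, hL0, hL⟩ := exists_tendsto_qPochhammer hq
  obtain ⟨C, hC⟩ := hL.norm.bddAbove_range
  obtain ⟨D, hD⟩ := (hL.inv₀ hL0).norm.bddAbove_range
  exact ⟨max C D, fun n => ⟨(hC ⟨n, rfl⟩).trans (le_max_left _ _),
    (hD ⟨n, rfl⟩).trans (le_max_right _ _)⟩⟩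

/-- The field identity requires `q ≠ 0`; at `q = 0` every term on both sides vanishes. -/
theorem sum_pochhammer_eq_sum_coneSum_complex (hq : ‖q‖ < 1) (N : ℕ) :
    ∑ n ∈ Finset.range N, (-1) ^ n * q ^ (n + 2).choose 2 * qPochhammer q q (n + 1) *
      qPochhammer q q n / qPochhammer q q (2 * (n + 1)) *
      (qPochhammer q q N / qPochhammer q q (N - (n + 1))) =
    ∑ r ∈ Finset.range N, q ^ ((r + 1) * (r + 1)) * coneSum q (r + 1) *
      (qPochhammer q q N / qPochhammer q q (N - (r + 1)) *
        (qPochhammer q q N / qPochhammer q q (N + (r + 1)))) := by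
  rcases eq_or_ne q 0 with rfl | h0
  · refine Finset.sum_congr rfl fun n _ => ?_
    have := succ_le_choose_two n
    rw [zero_pow (by omega), zero_pow (by positivity)]
    simp
  · exact sum_pochhammer_eq_sum_coneSum h0 (fun k hk => one_sub_pow_ne_zero hq hk) N

theorem norm_coneTerm_le (hq : ‖q‖ < 1) (r b : ℕ) :
    ‖if b < r + 1 then q ^ ((r + 1) * (r + 1) + b * (r + 1 - b)) else 0‖ ≤ ‖q‖ ^ r * ‖q‖ ^ b := by
  split_ifs with h
  · rw [norm_pow, ← pow_add]
    refine pow_le_pow_of_le_one (norm_nonneg q) hq.le ?_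
    nlinarith [Nat.zero_le (b * (r + 1 - b))]
  · rw [norm_zero]
    positivity

theorem summable_norm_pow_mul_norm_pow (hq : ‖q‖ < 1) :
    Summable fun x : ℕ × ℕ => ‖q‖ ^ x.1 * ‖q‖ ^ x.2 := by
  have h := summable_geometric_of_lt_one (norm_nonneg q) hq
  exact h.mul_of_nonneg h (fun _ => by positivity) (fun _ => by positivity)

theorem pow_mul_coneSum (q : ℂ) (r : ℕ) :
    q ^ ((r + 1) * (r + 1)) * coneSum q (r + 1) = ∑ b ∈ Finset.range (r + 1),
      if b < r + 1 then q ^ ((r + 1) * (r + 1) + b * (r + 1 - b)) else 0 := by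
  rw [coneSum, Finset.mul_sum]
  refine Finset.sum_congr rfl fun b hb => ?_
  rw [if_pos (Finset.mem_range.1 hb), pow_add]

/-- An absolutely convergent double series over `(r, b)` is summed by rows and by the value `N` of
the exponent. -/
theorem hasSum_coneSum (hq : ‖q‖ < 1) :
    HasSum (fun N : ℕ => ((GoldenInt.conePoints N).card : ℂ) * q ^ N)
      (∑' r : ℕ, q ^ ((r + 1) * (r + 1)) * coneSum q (r + 1)) := by
  set f : ℕ × ℕ → ℂ := fun x =>
    if x.2 < x.1 + 1 then q ^ ((x.1 + 1) * (x.1 + 1) + x.2 * (x.1 + 1 - x.2)) else 0 with hf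
  have hs : Summable f := Summable.of_norm_bounded (summable_norm_pow_mul_norm_pow hq)
    fun x => norm_coneTerm_le hq x.1 x.2
  have h1 : HasSum (fun r : ℕ => q ^ ((r + 1) * (r + 1)) * coneSum q (r + 1)) (∑' x, f x) := by
    refine hs.hasSum.prod_fiberwise fun r => ?_
    rw [pow_mul_coneSum]
    exact hasSum_sum_of_ne_finset_zero fun b hb => if_neg (by simpa using hb)
  rw [h1.tsum_eq]
  have h2 := hs.hasSum.tsum_fiberwise
    fun x : ℕ × ℕ => (x.1 + 1) * (x.1 + 1) + x.2 * (x.1 + 1 - x.2)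
  refine hasSum_of_eq h2 fun N => ?_
  rw [tsum_subtype, tsum_eq_sum (s := Finset.range N ×ˢ Finset.range (N + 1)), Finset.sum_product,
    card_conePoints_eq_sum]
  · push_cast
    rw [Finset.sum_mul]
    refine Finset.sum_congr rfl fun r hr => ?_
    rw [Finset.sum_mul, ← Finset.sum_subset (Finset.range_subset_range.2
      (Nat.succ_le_succ (Finset.mem_range.1 hr).le))]
    · refine Finset.sum_congr rfl fun b hb => ?_
      have hb' := Finset.mem_range.1 hb
      by_cases h : (r + 1) * (r + 1) + b * (r + 1 - b) = N
      · rw [Set.indicator_of_mem (by exact h), if_pos h, hf]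
        simp only [if_pos hb', h, one_mul]
      · rw [Set.indicator_of_notMem (by exact h), if_neg h, zero_mul]
    · intro b _ hb
      rw [Set.indicator_apply_eq_zero]
      intro _
      exact if_neg (by simpa using hb)
  · rintro ⟨r, b⟩ hx
    rw [Set.indicator_apply_eq_zero]
    intro h
    refine if_neg fun hb => hx ?_
    have h' : (r + 1) * (r + 1) + b * (r + 1 - b) = N := h
    have hb' : b < r + 1 := hb
    rw [Finset.mem_product, Finset.mem_range, Finset.mem_range]
    constructor <;> nlinarith [Nat.zero_le (b * (r + 1 - b))]

theorem summable_lambert_prod (hq : ‖q‖ < 1) :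
    Summable fun x : ℕ × ℕ => (kroneckerSymbol 5 (x.1 + 1) : ℂ) * q ^ ((x.1 + 1) * (x.2 + 1)) := by
  refine Summable.of_norm_bounded (summable_norm_pow_mul_norm_pow hq) fun x => ?_
  rw [norm_mul, norm_pow, ← pow_add]
  have h1 : ‖(kroneckerSymbol 5 (x.1 + 1) : ℂ)‖ ≤ 1 := by
    rw [Complex.norm_intCast]
    exact_mod_cast abs_kroneckerSymbol_le_one 5 x.1.succ_ne_zero
  refine (mul_le_of_le_one_left (by positivity) h1).trans ?_
  exact pow_le_pow_of_le_one (norm_nonneg q) hq.le (by nlinarith [Nat.zero_le (x.1 * x.2)])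

theorem hasSum_lambert (hq : ‖q‖ < 1) :
    HasSum (fun n : ℕ => (kroneckerSymbol 5 (n + 1) : ℂ) * q ^ (n + 1) / (1 - q ^ (n + 1)))
      (∑' x : ℕ × ℕ, (kroneckerSymbol 5 (x.1 + 1) : ℂ) * q ^ ((x.1 + 1) * (x.2 + 1))) := by
  refine (summable_lambert_prod hq).hasSum.prod_fiberwise fun n => ?_
  have h : ‖q ^ (n + 1)‖ < 1 := by
    rw [norm_pow]
    exact pow_lt_one₀ (norm_nonneg q) hq n.succ_ne_zero
  have := (hasSum_geometric_of_norm_lt_one h).mul_left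
    ((kroneckerSymbol 5 (n + 1) : ℂ) * q ^ (n + 1))
  rw [← div_eq_mul_inv] at this
  refine hasSum_of_eq this fun j => ?_
  rw [mul_assoc, ← pow_succ', ← pow_mul]

/-- The double series of `hasSum_lambert`, regrouped by the value `N` of the product of the two
shifted indices. -/
theorem hasSum_divisors (hq : ‖q‖ < 1) :
    HasSum (fun N : ℕ => ((∑ d ∈ N.divisors, kroneckerSymbol 5 d : ℤ) : ℂ) * q ^ N)
      (∑' x : ℕ × ℕ, (kroneckerSymbol 5 (x.1 + 1) : ℂ) * q ^ ((x.1 + 1) * (x.2 + 1))) := by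
  have h2 := (summable_lambert_prod hq).hasSum.tsum_fiberwise
    fun x : ℕ × ℕ => (x.1 + 1) * (x.2 + 1)
  refine hasSum_of_eq h2 fun N => ?_
  have hinj : Set.InjOn (fun x : ℕ × ℕ => (x.1 - 1, x.2 - 1)) N.divisorsAntidiagonal := by
    rintro ⟨a, b⟩ hx ⟨c, d⟩ hy h
    rw [SetLike.mem_coe, Nat.mem_divisorsAntidiagonal] at hx hy
    have ha := left_ne_zero_of_mul (hx.1 ▸ hx.2)
    have hb := right_ne_zero_of_mul (hx.1 ▸ hx.2)
    have hc := left_ne_zero_of_mul (hy.1 ▸ hy.2)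
    have hd := right_ne_zero_of_mul (hy.1 ▸ hy.2)
    simp only [Prod.mk.injEq] at h ha hb hc hd ⊢
    omega
  rw [tsum_subtype _ fun x : ℕ × ℕ =>
      (kroneckerSymbol 5 (x.1 + 1) : ℂ) * q ^ ((x.1 + 1) * (x.2 + 1)), tsum_eq_sum
    (s := N.divisorsAntidiagonal.image fun x : ℕ × ℕ => (x.1 - 1, x.2 - 1)),
    Finset.sum_image hinj, Int.cast_sum, Finset.sum_mul,
    ← Nat.sum_divisorsAntidiagonal (f := fun d _ => (kroneckerSymbol 5 d : ℂ) * q ^ N)]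
  · refine Finset.sum_congr rfl ?_
    rintro ⟨a, b⟩ hx
    rw [Nat.mem_divisorsAntidiagonal] at hx
    have ha : a - 1 + 1 = a := Nat.succ_pred (left_ne_zero_of_mul (hx.1 ▸ hx.2))
    have hb : b - 1 + 1 = b := Nat.succ_pred (right_ne_zero_of_mul (hx.1 ▸ hx.2))
    have hx1 : a * b = N := hx.1
    rw [Set.indicator_of_mem]
    · simp only [ha, hb, hx1]
    · simp [ha, hb, hx1]
  · rintro ⟨a, b⟩ hx
    refine Set.indicator_of_notMem (fun h => hx ?_) _
    have h' : (a + 1) * (b + 1) = N := h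
    rw [Finset.mem_image]
    exact ⟨(a + 1, b + 1), Nat.mem_divisorsAntidiagonal.2 ⟨h', h' ▸ by positivity⟩, by simp⟩

theorem hasSum_lambert_coneSum (hq : ‖q‖ < 1) :
    HasSum (fun n : ℕ => (kroneckerSymbol 5 (n + 1) : ℂ) * q ^ (n + 1) / (1 - q ^ (n + 1)))
      (∑' r : ℕ, q ^ ((r + 1) * (r + 1)) * coneSum q (r + 1)) := by
  have h : (fun N : ℕ => ((GoldenInt.conePoints N).card : ℂ) * q ^ N) =
      fun N : ℕ => ((∑ d ∈ N.divisors, kroneckerSymbol 5 d : ℤ) : ℂ) * q ^ N := by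
    ext N
    rcases eq_or_ne N 0 with rfl | hN
    · have h0 : GoldenInt.conePoints 0 = ∅ := by decide
      simp [h0]
    · rw [← GoldenInt.card_conePoints hN]
      push_cast
      rfl
  have h1 := hasSum_coneSum hq
  rw [h] at h1
  rw [h1.unique (hasSum_divisors hq)]
  exact hasSum_lambert hq

theorem summable_pochhammer (hq : ‖q‖ < 1) :
    Summable fun n : ℕ => ‖(-1) ^ n * q ^ (n + 2).choose 2 * qPochhammer q q (n + 1) *
      qPochhammer q q n / qPochhammer q q (2 * (n + 1))‖ := by
  obtain ⟨C, hC⟩ := exists_norm_qPochhammer_le hq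
  have hC0 : 0 ≤ C := (norm_nonneg _).trans (hC 0).1
  refine Summable.of_nonneg_of_le (fun _ => norm_nonneg _) (fun n => ?_)
    ((summable_geometric_of_lt_one (norm_nonneg q) hq).mul_right (C * C * C))
  have h1 := pow_le_pow_of_le_one (norm_nonneg q) hq.le
    ((Nat.le_succ n).trans (succ_le_choose_two n))
  rw [div_eq_mul_inv, norm_mul, norm_mul, norm_mul, norm_mul, norm_pow, norm_pow, norm_neg,
    norm_one, one_pow, one_mul, mul_assoc, mul_assoc, mul_assoc C C C]
  have h2 := (hC (n + 1)).1
  have h3 := (hC n).1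
  have h4 := (hC (2 * (n + 1))).2
  gcongr

theorem hasSum_pochhammer (hq : ‖q‖ < 1) :
    HasSum (fun n : ℕ => (-1) ^ n * q ^ (n + 2).choose 2 * qPochhammer q q (n + 1) *
      qPochhammer q q n / qPochhammer q q (2 * (n + 1)))
      (∑' r : ℕ, q ^ ((r + 1) * (r + 1)) * coneSum q (r + 1)) := by
  obtain ⟨C, hC⟩ := exists_norm_qPochhammer_le hq
  have hC0 : 0 ≤ C := (norm_nonneg _).trans (hC 0).1
  obtain ⟨L, hL0, hL⟩ := exists_tendsto_qPochhammer hq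
  have hdiv : ∀ m n, ‖qPochhammer q q m / qPochhammer q q n‖ ≤ C * C := fun m n => by
    rw [div_eq_mul_inv, norm_mul]
    exact mul_le_mul (hC m).1 (hC n).2 (norm_nonneg _) hC0
  have hsub : ∀ k, Tendsto (fun N => qPochhammer q q N / qPochhammer q q (N - k)) atTop (𝓝 1) := by
    intro k
    rw [← div_self hL0]
    exact hL.div (hL.comp (tendsto_sub_atTop_nat k)) hL0
  have hadd : ∀ k, Tendsto (fun N => qPochhammer q q N / qPochhammer q q (N + k)) atTop (𝓝 1) := by
    intro k
    rw [← div_self hL0]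
    exact hL.div (hL.comp (tendsto_add_atTop_nat k)) hL0
  -- Tannery's theorem, for weights that are uniformly bounded and tend to `1`; it is applied to
  -- each side of the finite identity.
  have tannery : ∀ (a : ℕ → ℂ) (w : ℕ → ℕ → ℂ) (D : ℝ), (Summable fun n => ‖a n‖) →
      (∀ N n, ‖w N n‖ ≤ D) → (∀ n, Tendsto (fun N => w N n) atTop (𝓝 1)) →
      Tendsto (fun N => ∑ n ∈ Finset.range N, a n * w N n) atTop (𝓝 (∑' n, a n)) := by
    intro a w D ha hw hlim
    have h := tendsto_tsum_of_dominated_convergence (𝓕 := atTop)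
      (f := fun N n => if n < N then a n * w N n else 0) (g := a) (ha.mul_right D) (fun n => ?_)
      (Eventually.of_forall fun N n => ?_)
    · refine h.congr fun N => ?_
      rw [tsum_eq_sum (s := Finset.range N)]
      · exact Finset.sum_congr rfl fun n hn => if_pos (Finset.mem_range.1 hn)
      · exact fun n hn => if_neg (by simpa using hn)
    · have h1 : Tendsto (fun N => a n * w N n) atTop (𝓝 (a n)) := by
        simpa using (hlim n).const_mul (a n)
      refine h1.congr' ?_
      filter_upwards [eventually_gt_atTop n] with N hN
      rw [if_pos hN]
    · split_ifs
      · rw [norm_mul]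
        exact mul_le_mul_of_nonneg_left (hw N n) (norm_nonneg _)
      · rw [norm_zero]
        exact mul_nonneg (norm_nonneg _) ((norm_nonneg _).trans (hw 0 0))
  have hcone : Summable fun r : ℕ => ‖q ^ ((r + 1) * (r + 1)) * coneSum q (r + 1)‖ := by
    have hg := summable_geometric_of_lt_one (norm_nonneg q) hq
    refine Summable.of_nonneg_of_le (fun _ => norm_nonneg _) (fun r => ?_)
      (hg.mul_right (∑' b : ℕ, ‖q‖ ^ b))
    rw [pow_mul_coneSum]
    refine (norm_sum_le _ _).trans ((Finset.sum_le_sum fun b _ => norm_coneTerm_le hq r b).trans ?_)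
    rw [← Finset.mul_sum]
    exact mul_le_mul_of_nonneg_left (hg.sum_le_tsum _ fun _ _ => by positivity) (by positivity)
  have hA := tannery _ _ _ (summable_pochhammer hq) (fun N n => hdiv N (N - (n + 1)))
    fun n => hsub (n + 1)
  have hB := tannery _ (fun N r => qPochhammer q q N / qPochhammer q q (N - (r + 1)) *
    (qPochhammer q q N / qPochhammer q q (N + (r + 1)))) (C * C * (C * C)) hcone
    (fun N r => by
      rw [norm_mul]
      exact mul_le_mul (hdiv _ _) (hdiv _ _) (norm_nonneg _) (mul_nonneg hC0 hC0))
    fun r => by simpa using (hsub (r + 1)).mul (hadd (r + 1))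
  simp_rw [sum_pochhammer_eq_sum_coneSum_complex hq] at hA
  rw [← tendsto_nhds_unique hA hB]
  exact (summable_pochhammer hq).of_norm.hasSum

end Complex

theorem theorem4p1 :
    -- the identity for complex `q` with `|q| < 1`, both series converging absolutely
    (∀ q : ℂ, ‖q‖ < 1 →
      (Summable fun n : ℕ+ =>
        (-1 : ℂ) ^ ((n : ℕ) - 1) * q ^ Nat.choose ((n : ℕ) + 1) 2 *
          qPochhammer q q (n : ℕ) * qPochhammer q q ((n : ℕ) - 1) /
          qPochhammer q q (2 * (n : ℕ))) ∧
      (Summable fun n : ℕ+ =>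
        (kroneckerSymbol 5 (n : ℕ) : ℂ) * q ^ (n : ℕ) / (1 - q ^ (n : ℕ))) ∧
      ∑' n : ℕ+,
        (-1 : ℂ) ^ ((n : ℕ) - 1) * q ^ Nat.choose ((n : ℕ) + 1) 2 *
          qPochhammer q q (n : ℕ) * qPochhammer q q ((n : ℕ) - 1) /
          qPochhammer q q (2 * (n : ℕ)) =
      ∑' n : ℕ+, (kroneckerSymbol 5 (n : ℕ) : ℂ) * q ^ (n : ℕ) / (1 - q ^ (n : ℕ))) ∧
    -- the identity of formal power series with integer coefficients, with coefficientwise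
    -- convergence (`ℤ` is discrete: each coefficient is nonzero in finitely many terms only)
    ((Summable fun n : ℕ+ =>
        (-1 : PowerSeries ℤ) ^ ((n : ℕ) - 1) * PowerSeries.X ^ Nat.choose ((n : ℕ) + 1) 2 *
          qPochhammer PowerSeries.X PowerSeries.X (n : ℕ) *
          qPochhammer PowerSeries.X PowerSeries.X ((n : ℕ) - 1) *
          PowerSeries.invOfUnit (qPochhammer PowerSeries.X PowerSeries.X (2 * (n : ℕ))) 1) ∧
      (Summable fun n : ℕ+ =>
        (kroneckerSymbol 5 (n : ℕ) : PowerSeries ℤ) * PowerSeries.X ^ (n : ℕ) *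
          PowerSeries.invOfUnit (1 - PowerSeries.X ^ (n : ℕ)) 1) ∧
      ∑' n : ℕ+,
        (-1 : PowerSeries ℤ) ^ ((n : ℕ) - 1) * PowerSeries.X ^ Nat.choose ((n : ℕ) + 1) 2 *
          qPochhammer PowerSeries.X PowerSeries.X (n : ℕ) *
          qPochhammer PowerSeries.X PowerSeries.X ((n : ℕ) - 1) *
          PowerSeries.invOfUnit (qPochhammer PowerSeries.X PowerSeries.X (2 * (n : ℕ))) 1 =
      ∑' n : ℕ+,
        (kroneckerSymbol 5 (n : ℕ) : PowerSeries ℤ) * PowerSeries.X ^ (n : ℕ) *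
          PowerSeries.invOfUnit (1 - PowerSeries.X ^ (n : ℕ)) 1) := by
  refine ⟨fun q hq => ?_, ?_⟩
  · have h1 := hasSum_pnat_iff_hasSum_succ (f := fun n : ℕ => (-1 : ℂ) ^ (n - 1) *
      q ^ Nat.choose (n + 1) 2 * qPochhammer q q n * qPochhammer q q (n - 1) /
      qPochhammer q q (2 * n)) |>.2 (hasSum_pochhammer hq)
    have h2 := hasSum_pnat_iff_hasSum_succ (f := fun n : ℕ =>
      (kroneckerSymbol 5 n : ℂ) * q ^ n / (1 - q ^ n)) |>.2 (hasSum_lambert_coneSum hq)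
    exact ⟨h1.summable, h2.summable, h1.tsum_eq.trans h2.tsum_eq.symm⟩
  · have h1 := hasSum_pnat_iff_hasSum_succ (f := fun n : ℕ => (-1 : PowerSeries ℤ) ^ (n - 1) *
      PowerSeries.X ^ Nat.choose (n + 1) 2 * qPochhammer PowerSeries.X PowerSeries.X n *
      qPochhammer PowerSeries.X PowerSeries.X (n - 1) *
      PowerSeries.invOfUnit (qPochhammer PowerSeries.X PowerSeries.X (2 * n)) 1) |>.2
      hasSum_pochhammer_powerSeries
    have h2 := hasSum_pnat_iff_hasSum_succ (f := fun n : ℕ => (kroneckerSymbol 5 n : PowerSeries ℤ) *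
      PowerSeries.X ^ n * PowerSeries.invOfUnit (1 - PowerSeries.X ^ n) 1) |>.2
      hasSum_lambert_powerSeries
    exact ⟨h1.summable, h2.summable, h1.tsum_eq.trans h2.tsum_eq.symm⟩
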